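/- Let $N=\{0,1\}^n$, $D=\{0,1\}^d$, $M'=\{0,1\}^{m'}$, let $\mathrm{Ext}=\{f_s\}_{s\in D}$ be a family of functions $f_s:N\to M'$, let $k\in\mathbb R$ and $\varepsilon>0$; $\log$ is to base $2$. For a set $X$ we also write $X$ for its cardinality, and $\upsilon_X$ for the uniform distribution on $X$. Let $F_s$ be the linear map with $F_s(P)(y)=\sum_{x:f_s(x)=y}P(x)$, and let $$\Delta[\mathrm{Ext}]_S(P)=\frac1D\sum_{s\in D}F_s(P)\otimes|s\rangle\langle s|-\Big(\sum_xP(x)\Big)\,\upsilon_{M'}\otimes\upsilon_D .$$ *Norms.* For a vector $P$ on $N$ put $\|P\|_{\cap\{K\ell_\infty,\ell_1\}}=\max\{K\|P\|_{\ell_\infty},\|P\|_{\ell_1}\}$. The bounded norm of a linear map $u$ is $\sup\{\|u(P)\|:\|P\|\le1\}$ (scalars real or complex, the statement holds for either). For $Q\in\mathbb N$ view $x\in\mathrm{Mat}_Q(\mathbb C^N)$ as a block-diagonal matrix in $\mathrm{Mat}_Q\otimes\mathrm{Mat}_N$. Write $\|\cdot\|_\infty,\|\cdot\|_1,\|\cdot\|_2$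 for the operator, trace and Hilbert--Schmidt norms, let $\Gamma$ be the linear map with $\Gamma(|i\rangle\langle j|\otimes|k\rangle\langle l|)=|i\rangle\langle j|\otimes\langle k|\otimes\langle l|$, and put $|a|_K=\max\{\sqrt K\|a\|_\infty,\|\Gamma(a)\|_\infty\}$. The operator space $\cap\cdot\cap\{K\ell_\infty,\ell_1\}$ on $\mathbb C^N$ has the norms $$\|x\|_{M_Q(\cap\cdot\cap)}=\inf\{|a|_K\,|b|_K:\ x=ab^*,\ a,b\in\mathrm{Mat}_Q\otimes\mathrm{Mat}_N\},$$ and the operator space $\ell_1$ on $\mathbb C^{X}$ has the norms $$\|x\|_{M_Q(\ell_1)}=\sup\{\|(A\otimes1)x(B\otimes1)\|_1:\ A,B\in\mathrm{Mat}_Q,\ \|A\|_2,\|B\|_2\le1\}.$$ The completely bounded norm is $\|u:E\to F\|_{\mathrm{cb}}=\sup_{Q\in\mathbb N}\sup\{\|(\mathrm{id}_Q\otimes u)(x)\|_{M_Q(F)}:\ \|x\|_{M_Q(E)}\le1\}$. *Extractors.* $\mathrm{Ext}$ is a strong $(k,\varepsilon)$-extractor if $\frac1D\sum_s\|F_s(P)-\upsilon_{M'}\|_{\ell_1}\le\varepsilon$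 for every probability distribution $P$ on $N$ with $-\log\|P\|_{\ell_\infty}\ge k$. It is a quantum-proof strong $(k,\varepsilon)$-extractor if for every finite-dimensional $Q$ and every classical-quantum density matrix $\rho_{QN}=\sum_x\rho_x\otimes|x\rangle\langle x|$ with $H_{\min}(N|Q)_\rho\ge k$ one has $\frac1D\sum_s\|(\mathrm{id}\otimes F_s)(\rho_{QN})-\rho_Q\otimes\upsilon_{M'}\|_1\le\varepsilon$; here $H_{\min}(N|Q)_\rho=-\log\min_\sigma\|(\sigma^{-1/2}\otimes1)\rho_{QN}(\sigma^{-1/2}\otimes1)\|_\infty$, with generalized inverses and the minimum over density matrices $\sigma$ on $Q$ whose support contains that of $\rho_Q$. **Theorem.** (a) If $$\big\|\Delta[\mathrm{Ext}]_S:\cap\{2^k\ell_\infty,\ell_1\}\to\ell_1\big\|\le\varepsilon,$$ then $$\big\|\Delta[\mathrm{Ext}]_S:\cap\cdot\cap\{2^{k+\log(1/\varepsilon)}\ell_\infty,\ell_1\}\to\ell_1\big\|_{\mathrm{cb}}\le4\sqrt{2^{m'}}\sqrt{2\varepsilon}.$$ (b) If $\mathrm{Ext}$ is a strong $(k,\varepsilon)$-extractor,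 then it is a quantum-proof strong $\big(k+\log(2/\varepsilon),\,12\sqrt{2^{m'}}\sqrt{2\varepsilon}\big)$-extractor. -/

import Mathlib

open scoped ENNReal Matrix Kronecker ComplexOrder

noncomputable section

namespace QExt

/-! ## Matrix norms -/

section MatrixNorms

variable {ι κ : Type*} [Fintype ι] [DecidableEq ι] [Fintype κ] [DecidableEq κ]

open scoped Matrix.Norms.L2Operator in
/-- The operator norm (largest singular value) of a complex, possibly rectangular, matrix. -/
def opNorm (A : Matrix ι κ ℂ) : ℝ := ‖A‖

/-- The trace norm `Tr √(A* A)`. -/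
def traceNorm (A : Matrix ι ι ℂ) : ℝ := (cfc Real.sqrt (Aᴴ * A)).trace.re

/-- The Hilbert-Schmidt norm `√(Tr (A* A))`. -/
def hsNorm (A : Matrix ι ι ℂ) : ℝ := Real.sqrt (Aᴴ * A).trace.re

/-- `σ ^ (-1/2)` for a positive semidefinite `σ`, with the generalized inverse
(eigenvalue `0` is sent to `0`). -/
def invSqrt (σ : Matrix ι ι ℂ) : Matrix ι ι ℂ := cfc (fun t : ℝ => (Real.sqrt t)⁻¹) σ

end MatrixNorms

/-! ## Bounded and completely bounded norms of linear maps

Norms are given as functions with values in `[0, ∞]`, so that suprema and infima are genuine. -/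

/-- The bounded norm `sup {‖u x‖_W : ‖x‖_V ≤ 1}`. -/
def boundedNorm {𝕜 V W : Type*} [RCLike 𝕜] [AddCommGroup V] [Module 𝕜 V] [AddCommGroup W]
    [Module 𝕜 W] (nV : V → ℝ≥0∞) (nW : W → ℝ≥0∞) (u : V →ₗ[𝕜] W) : ℝ≥0∞ :=
  ⨆ (x : V) (_ : nV x ≤ 1), nW (u x)

/-- The completely bounded norm: the supremum over `Q` of the bounded norms of
`u_Q : Mat_Q(V) → Mat_Q(W)`, where `u_Q` applies `u` to every entry. The arguments `nV Q` and
`nW Q` are the norms on `Mat_Q(V)` and on `Mat_Q(W)`. -/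
def cbNorm {V W : Type*} [AddCommGroup V] [Module ℂ V] [AddCommGroup W] [Module ℂ W]
    (nV : ∀ Q : ℕ, Matrix (Fin Q) (Fin Q) V → ℝ≥0∞)
    (nW : ∀ Q : ℕ, Matrix (Fin Q) (Fin Q) W → ℝ≥0∞) (u : V →ₗ[ℂ] W) : ℝ≥0∞ :=
  ⨆ (Q : ℕ) (x : Matrix (Fin Q) (Fin Q) V) (_ : nV Q x ≤ 1), nW Q (x.map u)

section VectorNorms

variable {𝕜 N : Type*} [RCLike 𝕜] [Fintype N]

/-- The `ℓ₁` norm of a vector. -/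
def l1Norm (P : N → 𝕜) : ℝ := ∑ x, ‖P x‖

/-- The `ℓ_∞` norm of a vector (Mathlib's norm on functions on a finite type). -/
def linftyNorm (P : N → 𝕜) : ℝ := ‖P‖

/-- The norm of `∩{K ℓ_∞, ℓ₁}`. -/
def capNorm (K : ℝ) (P : N → 𝕜) : ℝ := max (K * linftyNorm P) (l1Norm P)

end VectorNorms

/-! ## Operator space structures on `ℂ^N`

An element of `Mat_Q(N)` is a `Q × Q` matrix with entries in `ℂ^N`; it is embedded into the
`QN × QN` matrices as the block-diagonal matrix `∑ x, ρ(x) ⊗ |x⟩⟨x|`. -/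

section OperatorSpaces

variable {N : Type*} [Fintype N] [DecidableEq N]

/-- The embedding of `Mat_Q(N)` into `Mat_{QN}` as block-diagonal matrices. -/
def blockEmbed {Q : ℕ} (z : Matrix (Fin Q) (Fin Q) (N → ℂ)) :
    Matrix (Fin Q × N) (Fin Q × N) ℂ :=
  Matrix.of fun p q => if p.2 = q.2 then z p.1 q.1 p.2 else 0

/-- `Γ(|i⟩⟨j| ⊗ |k⟩⟨l|) = |i⟩⟨j| ⊗ ⟨k| ⊗ ⟨l|`, extended linearly. -/
def Gam {Q : ℕ} (a : Matrix (Fin Q × N) (Fin Q × N) ℂ) : Matrix (Fin Q) (Fin Q × N × N) ℂ :=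
  Matrix.of fun i p => a (i, p.2.1) (p.1, p.2.2)

/-- `max {√K ‖a‖_{(∞;∞)}, ‖Γ(a)‖_∞}`, the size of one factor in the `∩·∩` norm. -/
def factorNorm {Q : ℕ} (K : ℝ) (a : Matrix (Fin Q × N) (Fin Q × N) ℂ) : ℝ :=
  max (Real.sqrt K * opNorm a) (opNorm (Gam a))

/-- The norm on `Mat_{QN}` of the operator space `∩·∩{K M_N, S¹_N}`: an infimum over
factorizations `x = a b*`. -/
def capcapMat {Q : ℕ} (K : ℝ) (x : Matrix (Fin Q × N) (Fin Q × N) ℂ) : ℝ≥0∞ :=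
  ⨅ (a : Matrix (Fin Q × N) (Fin Q × N) ℂ) (b : Matrix (Fin Q × N) (Fin Q × N) ℂ)
    (_ : x = a * bᴴ), ENNReal.ofReal (factorNorm K a * factorNorm K b)

/-- The norms of the operator space `∩·∩{K ℓ_∞, ℓ₁}` on `ℂ^N`. -/
def capcapNorm (K : ℝ) (Q : ℕ) (z : Matrix (Fin Q) (Fin Q) (N → ℂ)) : ℝ≥0∞ :=
  capcapMat K (blockEmbed z)

/-- The `(∞;1)` norm on `Mat_{QN}`, which is the norm on `Mat_Q` of the trace class operator
space `S¹_N`: the supremum of the trace norms of `(A ⊗ 1) x (B ⊗ 1)` over `A`, `B` in the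
Hilbert-Schmidt unit ball. -/
def infOneMat {Q : ℕ} (x : Matrix (Fin Q × N) (Fin Q × N) ℂ) : ℝ≥0∞ :=
  ⨆ (A : Matrix (Fin Q) (Fin Q) ℂ) (B : Matrix (Fin Q) (Fin Q) ℂ)
    (_ : hsNorm A ≤ 1) (_ : hsNorm B ≤ 1),
    ENNReal.ofReal
      (traceNorm ((A ⊗ₖ (1 : Matrix N N ℂ)) * x * (B ⊗ₖ (1 : Matrix N N ℂ))))

/-- The norms of the operator space `ℓ₁` on `ℂ^N`. -/
def l1OpNorm (Q : ℕ) (z : Matrix (Fin Q) (Fin Q) (N → ℂ)) : ℝ≥0∞ :=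
  infOneMat (blockEmbed z)

end OperatorSpaces

/-! ## Extractors -/

section Extractors

variable {N D M : Type*} [Fintype N] [DecidableEq N] [Fintype D] [DecidableEq D]
  [Fintype M] [DecidableEq M]

/-- The linear map `F_s` of a function `g = f_s : N → M`, given by the `M × N` matrix whose
`(y, x)` entry is `1` if `g x = y` and `0` otherwise. -/
def push (𝕜 : Type*) [RCLike 𝕜] (g : N → M) : (N → 𝕜) →ₗ[𝕜] (M → 𝕜) :=
  Matrix.mulVecLin (Matrix.of fun y x => if g x = y then 1 else 0)

/-- `Δ[Ext]_S (P) = (1/D) ∑ s, F_s(P) ⊗ |s⟩⟨s| - (1ᵀ P) υ_M ⊗ υ_D`, where `υ` is uniform;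
the `(y, s)` coordinate of `∑ s, F_s(P) ⊗ |s⟩⟨s|` is `F_s(P)(y)`. -/
def deltaS (𝕜 : Type*) [RCLike 𝕜] (f : D → N → M) : (N → 𝕜) →ₗ[𝕜] (M × D → 𝕜) where
  toFun P := fun p => (Fintype.card D : 𝕜)⁻¹ * push 𝕜 (f p.2) P p.1
    - (∑ x, P x) * ((Fintype.card M : 𝕜)⁻¹ * (Fintype.card D : 𝕜)⁻¹)
  map_add' P R := by
    ext p
    simp only [map_add, Pi.add_apply, Finset.sum_add_distrib]
    ring
  map_smul' c P := by
    ext p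
    simp only [map_smul, Pi.smul_apply, smul_eq_mul, ← Finset.mul_sum, RingHom.id_apply]
    ring

/-- The min-entropy (in bits) of a probability distribution. -/
def minEntropy (P : N → ℝ) : ℝ := -Real.logb 2 (linftyNorm P)

/-- `f` is a strong `(k, ε)`-extractor: for every probability distribution `P` on `N` of
min-entropy at least `k`, `(1/D) ∑ s, ‖F_s(P) - υ_M‖₁ ≤ ε`. -/
def IsStrongExtractor (f : D → N → M) (k ε : ℝ) : Prop :=
  ∀ P : N → ℝ, (∀ x, 0 ≤ P x) → ∑ x, P x = 1 → k ≤ minEntropy P →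
    (Fintype.card D : ℝ)⁻¹ *
      ∑ s, l1Norm (push ℝ (f s) P - fun _ => (Fintype.card M : ℝ)⁻¹) ≤ ε

/-- The marginal on `Q` of an element of `Mat_Q(N)`. -/
def marginal {Q : ℕ} (ρ : Matrix (Fin Q) (Fin Q) (N → ℂ)) : Matrix (Fin Q) (Fin Q) ℂ :=
  ρ.map fun v => ∑ x, v x

/-- Classical-quantum density matrices. -/
def IsCQState {Q : ℕ} (ρ : Matrix (Fin Q) (Fin Q) (N → ℂ)) : Prop :=
  (blockEmbed ρ).PosSemidef ∧ (blockEmbed ρ).trace = 1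

/-- The conditional min-entropy
`-log min_σ ‖(σ^(-1/2) ⊗ 1) ρ (σ^(-1/2) ⊗ 1)‖_{(∞;∞)}` (in bits). The minimum is over the states
`σ` on `Q` whose support contains that of `ρ_Q`, as always when generalized inverses are used. -/
def condMinEntropy {Q : ℕ} (ρ : Matrix (Fin Q) (Fin Q) (N → ℂ)) : ℝ :=
  -Real.logb 2 (sInf {r : ℝ | ∃ σ : Matrix (Fin Q) (Fin Q) ℂ, σ.PosSemidef ∧ σ.trace = 1 ∧
    (∀ v, σ *ᵥ v = 0 → marginal ρ *ᵥ v = 0) ∧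
    r = opNorm ((invSqrt σ ⊗ₖ (1 : Matrix N N ℂ)) * blockEmbed ρ *
      (invSqrt σ ⊗ₖ (1 : Matrix N N ℂ)))})

/-- `ρ_Q ⊗ υ_M` as an element of `Mat_Q(M)`. -/
def tensorUniform {Q : ℕ} (M : Type*) [Fintype M] (ρQ : Matrix (Fin Q) (Fin Q) ℂ) :
    Matrix (Fin Q) (Fin Q) (M → ℂ) :=
  ρQ.map fun c _ => c * (Fintype.card M : ℂ)⁻¹

/-- `f` is a quantum-proof strong `(k, ε)`-extractor: for every finite-dimensional `Q` and every
classical-quantum state `ρ_{QN}` with conditional min-entropy at least `k`,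
`(1/D) ∑ s, ‖(id ⊗ F_s)(ρ_{QN}) - ρ_Q ⊗ υ_M‖₁ ≤ ε`. -/
def IsQuantumProofStrongExtractor (f : D → N → M) (k ε : ℝ) : Prop :=
  ∀ (Q : ℕ) (ρ : Matrix (Fin Q) (Fin Q) (N → ℂ)), IsCQState ρ → k ≤ condMinEntropy ρ →
    (Fintype.card D : ℝ)⁻¹ *
      ∑ s, traceNorm (blockEmbed (ρ.map (push ℂ (f s)) - tensorUniform M (marginal ρ))) ≤ ε

end Extractors

end QExt

end

namespace QExt

/-! Let δ_p(x), with p = (y, s), be the real matrix of Δ, let z_x be the blocks of the input and Y_p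
= ∑_x δ_p(x) z_x those of the output. By duality and polar decomposition, each trace norm to be
bounded is S = ∑_p Re Tr(W_p α Y_p β), with contractions W_p and α, β ≥ 0 in the Hilbert–Schmidt
unit ball. Cauchy–Schwarz over the M·D indices gives S² ≤ MD ∑_p Tr(α Y_p β Y_p*). Expanding only
the last factor and using |δ_p(x')| ≤ 1/D leaves S² ≤ M ∑_{x'} ‖Δ(q_{x'})‖₁, where q_{x'}(x) = Re
Tr(α z_x β z_{x'}*) is a real vector for each x'. So the quantum problem becomes a family of
classical ones, at the price of √M and of √ε in place of ε (`sq_sum_trace_le`,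
`sum_trace_deltaCoef_le`). It remains to bound the sup norm and the ℓ₁ norm of q_{x'} by weights
w(x') with bounded sum.

For (a), z_x = a_x b_x* with row blocks a_x, b_x of a factorization. The two terms of the factor
norm bound each a_x a_x* and the sum ∑_x a_x a_x*, likewise for b, and these transfer to q_{x'}
(`traceNorm_deltaS_le_of_factor`).

Part (b) is not deduced from (a): the extractor property concerns probability vectors only. Here z_x
= R⁻¹ ρ_x R⁻¹ and α = β = R, where R² is an invertible state dominating, up to a factor 3, both ρ_Q
and a near-optimal σ for the min-entropy. Then q_{x'}(x) = Tr(ρ_x z_{x'}) is nonnegative and can be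
normalized to a distribution of min-entropy at least k, unless its mass is so small that ‖Δ‖ ≤ 2
suffices (`IsStrongExtractor.sum_abs_deltaCoef_le`). -/

lemma opNorm_nonneg {ι κ : Type*} [Fintype ι] [Fintype κ] [DecidableEq κ]
    (A : Matrix ι κ ℂ) : 0 ≤ opNorm A := by
  open scoped Matrix.Norms.L2Operator in
  exact norm_nonneg A

lemma opNorm_mul_le {ι κ μ : Type*} [Fintype ι] [Fintype κ] [DecidableEq κ] [Fintype μ]
    [DecidableEq μ] (A : Matrix ι κ ℂ) (B : Matrix κ μ ℂ) :
    opNorm (A * B) ≤ opNorm A * opNorm B :=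
  Matrix.l2_opNorm_mul A B

/-! ### Trace inequalities, polar decomposition, operator Cauchy–Schwarz -/

lemma trace_mul_conjTranspose_re_nonneg {ι κ : Type*} [Fintype ι] [Fintype κ]
    (X : Matrix ι κ ℂ) : 0 ≤ (X * Xᴴ).trace.re :=
  (Complex.le_def.mp (Matrix.posSemidef_self_mul_conjTranspose X).trace_nonneg).1

lemma two_mul_trace_mul_re_le {ι κ : Type*} [Fintype ι] [Fintype κ]
    (X : Matrix ι κ ℂ) (Y : Matrix κ ι ℂ) :
    2 * (X * Y).trace.re ≤ (X * Xᴴ).trace.re + (Yᴴ * Y).trace.re := by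
  have h := trace_mul_conjTranspose_re_nonneg (X - Yᴴ)
  have e : (Yᴴ * Xᴴ).trace.re = (X * Y).trace.re := by
    rw [← Matrix.conjTranspose_mul, Matrix.trace_conjTranspose]
    simp
  rw [Matrix.conjTranspose_sub, Matrix.conjTranspose_conjTranspose, Matrix.mul_sub,
    Matrix.sub_mul, Matrix.sub_mul] at h
  simp only [Matrix.trace_sub, Complex.sub_re, e] at h
  linarith

lemma two_mul_abs_trace_mul_re_le {ι κ : Type*} [Fintype ι] [Fintype κ]
    (X : Matrix ι κ ℂ) (Y : Matrix κ ι ℂ) :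
    2 * |(X * Y).trace.re| ≤ (X * Xᴴ).trace.re + (Yᴴ * Y).trace.re := by
  have h1 := two_mul_trace_mul_re_le X Y
  have h2 := two_mul_trace_mul_re_le (-X) Y
  simp only [Matrix.neg_mul, Matrix.trace_neg, Complex.neg_re, Matrix.conjTranspose_neg,
    Matrix.mul_neg, neg_neg] at h2
  rcases abs_cases (X * Y).trace.re with h | h <;> linarith

variable {ι κ : Type*} [Fintype ι] [DecidableEq ι] [Fintype κ] [DecidableEq κ]

lemma opNorm_conjTranspose (A : Matrix ι κ ℂ) : opNorm Aᴴ = opNorm A :=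
  Matrix.l2_opNorm_conjTranspose A

lemma opNorm_mul_le_one {A B : Matrix ι ι ℂ} (hA : opNorm A ≤ 1) (hB : opNorm B ≤ 1) :
    opNorm (A * B) ≤ 1 :=
  (opNorm_mul_le A B).trans (mul_le_one₀ hA (opNorm_nonneg B) hB)

lemma spectrum_nonneg {P : Matrix ι ι ℂ} (hP : P.PosSemidef) : ∀ t ∈ spectrum ℝ P, 0 ≤ t := by
  open scoped MatrixOrder in
  exact fun t ht => spectrum_nonneg_of_nonneg (Matrix.nonneg_iff_posSemidef.mpr hP) ht

lemma posSemidef_smul_one_sub {A : Matrix ι ι ℂ} (hA : A.IsHermitian) {r : ℝ}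
    (hr : opNorm A ≤ r) : (r • (1 : Matrix ι ι ℂ) - A).PosSemidef := by
  open scoped Matrix.Norms.L2Operator MatrixOrder in
  have h1 : A ≤ algebraMap ℝ (Matrix ι ι ℂ) ‖A‖ := IsSelfAdjoint.le_algebraMap_norm_self hA
  open scoped Matrix.Norms.L2Operator MatrixOrder in
  have h2 : algebraMap ℝ (Matrix ι ι ℂ) ‖A‖ ≤ algebraMap ℝ (Matrix ι ι ℂ) r :=
    algebraMap_mono _ hr
  open scoped Matrix.Norms.L2Operator MatrixOrder in
  have h3 := Matrix.le_iff.mp (h1.trans h2)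
  rwa [Algebra.algebraMap_eq_smul_one] at h3

lemma posSemidef_sq_smul_one_sub (A : Matrix ι κ ℂ) {s : ℝ} (hs : opNorm A ≤ s) :
    (s ^ 2 • (1 : Matrix ι ι ℂ) - A * Aᴴ).PosSemidef := by
  refine posSemidef_smul_one_sub (Matrix.isHermitian_mul_conjTranspose_self A) ?_
  refine (opNorm_mul_le A Aᴴ).trans ?_
  rw [opNorm_conjTranspose, ← sq]
  exact pow_le_pow_left₀ (opNorm_nonneg A) hs 2

/-- Polar decomposition: `X = V |X|` and `|X| = V* X` with a contraction `V`. -/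
lemma exists_polar (X : Matrix ι ι ℂ) : ∃ V : Matrix ι ι ℂ, opNorm V ≤ 1 ∧
    X = V * cfc Real.sqrt (Xᴴ * X) ∧ cfc Real.sqrt (Xᴴ * X) = Vᴴ * X := by
  have hP : (Xᴴ * X).PosSemidef := Matrix.posSemidef_conjTranspose_mul_self X
  have hsa : IsSelfAdjoint (Xᴴ * X) := hP.1
  have hc : ∀ g : ℝ → ℝ, ContinuousOn g (spectrum ℝ (Xᴴ * X)) := fun g =>
    (Matrix.finite_real_spectrum).continuousOn g
  have hpos : ∀ t ∈ spectrum ℝ (Xᴴ * X), 0 ≤ t := spectrum_nonneg hP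
  set P := Xᴴ * X with hPdef
  have hmul : ∀ g h : ℝ → ℝ, cfc g P * cfc h P = cfc (fun t => g t * h t) P := fun g h =>
    (cfc_mul g h P (hc g) (hc h)).symm
  have hid : cfc (fun t : ℝ => t) P = P := cfc_id' ℝ P
  have hstar : ∀ g : ℝ → ℝ, (cfc g P)ᴴ = cfc g P := fun g => cfc_predicate g P
  have hVV : (X * cfc (fun t : ℝ => (Real.sqrt t)⁻¹) P)ᴴ * X = cfc Real.sqrt P := by
    rw [Matrix.conjTranspose_mul, hstar, Matrix.mul_assoc, ← hPdef]
    nth_rewrite 2 [← hid]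
    rw [hmul]
    refine cfc_congr fun t ht => ?_
    have := hpos t ht
    rcases this.eq_or_lt with h | h
    · simp [← h]
    · have := Real.sqrt_pos.mpr h
      field_simp
      exact (Real.sq_sqrt h.le).symm
  refine ⟨X * cfc (fun t : ℝ => (Real.sqrt t)⁻¹) P, ?_, ?_, hVV.symm⟩
  -- V* V is a function of X* X with values 0 and 1 on the spectrum.
  · have h1 : opNorm ((X * cfc (fun t : ℝ => (Real.sqrt t)⁻¹) P)ᴴ *
        (X * cfc (fun t : ℝ => (Real.sqrt t)⁻¹) P)) ≤ 1 := by
      rw [← Matrix.mul_assoc, hVV, hmul]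
      open scoped Matrix.Norms.L2Operator in
      refine norm_cfc_le zero_le_one fun t ht => ?_
      have := hpos t ht
      rcases this.eq_or_lt with h | h
      · simp [← h]
      · have := Real.sqrt_pos.mpr h
        rw [mul_inv_cancel₀ this.ne']
        simp
    have h2 := Matrix.l2_opNorm_conjTranspose_mul_self
      (X * cfc (fun t : ℝ => (Real.sqrt t)⁻¹) P)
    change opNorm _ = opNorm _ * opNorm _ at h2
    rw [h2] at h1
    nlinarith [opNorm_nonneg (X * cfc (fun t : ℝ => (Real.sqrt t)⁻¹) P)]
  -- X - V|X| is X times the spectral projection of X* X onto its kernel, so its Gram matrix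
  -- vanishes.
  · rw [Matrix.mul_assoc, hmul, ← sub_eq_zero, ← Matrix.conjTranspose_mul_self_eq_zero]
    have e : X - X * cfc (fun t : ℝ => (Real.sqrt t)⁻¹ * Real.sqrt t) P =
        X * cfc (fun t : ℝ => 1 - (Real.sqrt t)⁻¹ * Real.sqrt t) P := by
      rw [cfc_sub (fun _ : ℝ => (1 : ℝ)) (fun t : ℝ => (Real.sqrt t)⁻¹ * Real.sqrt t) P
        (hc _) (hc _), cfc_const_one ℝ P, Matrix.mul_sub, Matrix.mul_one]
    rw [e, Matrix.conjTranspose_mul, hstar, Matrix.mul_assoc, ← Matrix.mul_assoc Xᴴ, ← hPdef]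
    nth_rewrite 2 [← hid]
    rw [hmul, hmul]
    rw [← cfc_const_zero ℝ P]
    refine cfc_congr fun t ht => ?_
    have := hpos t ht
    rcases this.eq_or_lt with h | h
    · simp [← h]
    · have := Real.sqrt_pos.mpr h
      simp [this.ne']

lemma exists_traceNorm_eq (X : Matrix ι ι ℂ) :
    ∃ U : Matrix ι ι ℂ, opNorm U ≤ 1 ∧ traceNorm X = (U * X).trace.re := by
  obtain ⟨V, hV, -, h⟩ := exists_polar X
  exact ⟨Vᴴ, by rwa [opNorm_conjTranspose], by rw [traceNorm, h]⟩

lemma posSemidef_cfc_sqrt (P : Matrix ι ι ℂ) : (cfc Real.sqrt P).PosSemidef := by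
  open scoped Matrix.Norms.L2Operator MatrixOrder in
  exact Matrix.nonneg_iff_posSemidef.mp (cfc_nonneg fun t _ => Real.sqrt_nonneg t)

lemma cfc_sqrt_mul_self {P : Matrix ι ι ℂ} (hP : P.PosSemidef) :
    cfc Real.sqrt P * cfc Real.sqrt P = P := by
  have hsa : IsSelfAdjoint P := hP.1
  have hc : ∀ g : ℝ → ℝ, ContinuousOn g (spectrum ℝ P) := fun g =>
    (Matrix.finite_real_spectrum).continuousOn g
  have hpos : ∀ t ∈ spectrum ℝ P, 0 ≤ t := spectrum_nonneg hP
  rw [← cfc_mul _ _ P (hc _) (hc _)]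
  conv_rhs => rw [← cfc_id' ℝ P]
  exact cfc_congr fun t ht => Real.mul_self_sqrt (hpos t ht)

lemma trace_mul_re_nonneg {P R : Matrix ι ι ℂ} (hP : P.PosSemidef) (hR : R.PosSemidef) :
    0 ≤ (P * R).trace.re := by
  have h := (hR.mul_mul_conjTranspose_same (cfc Real.sqrt P)).trace_nonneg
  rw [(posSemidef_cfc_sqrt P).1.eq, Matrix.trace_mul_comm, ← Matrix.mul_assoc,
    cfc_sqrt_mul_self hP] at h
  exact (Complex.le_def.mp h).1

lemma trace_mul_re_mono {P Q R : Matrix ι ι ℂ} (hPQ : (Q - P).PosSemidef)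
    (hR : R.PosSemidef) : (P * R).trace.re ≤ (Q * R).trace.re := by
  have := trace_mul_re_nonneg hPQ hR
  rw [Matrix.sub_mul, Matrix.trace_sub, Complex.sub_re] at this
  linarith

lemma trace_mul_re_mono' {P Q R : Matrix ι ι ℂ} (hPQ : (Q - P).PosSemidef)
    (hR : R.PosSemidef) : (R * P).trace.re ≤ (R * Q).trace.re := by
  rw [Matrix.trace_mul_comm R, Matrix.trace_mul_comm R]
  exact trace_mul_re_mono hPQ hR

/-- The arithmetic-geometric inequality for the Hilbert–Schmidt pairing separates W* β W from α;
then W W* ≤ 1, used twice, removes W from the first square. -/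
lemma trace_conj_contraction_re_le_one {W α β : Matrix ι ι ℂ} (hW : opNorm W ≤ 1)
    (hα : α.PosSemidef) (hβ : β.PosSemidef) (hα1 : (α * α).trace.re ≤ 1)
    (hβ1 : (β * β).trace.re ≤ 1) : (Wᴴ * β * W * α).trace.re ≤ 1 := by
  have h1 := two_mul_trace_mul_re_le (Wᴴ * β * W) α
  have hWW : (1 - W * Wᴴ).PosSemidef := by
    simpa using posSemidef_sq_smul_one_sub W hW
  have e1 : ((Wᴴ * β * W) * (Wᴴ * β * W)ᴴ).trace =
      ((W * Wᴴ) * (β * (W * Wᴴ) * βᴴ)).trace := by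
    simp only [Matrix.conjTranspose_mul, Matrix.conjTranspose_conjTranspose, hβ.1.eq]
    rw [Matrix.mul_assoc Wᴴ, Matrix.mul_assoc Wᴴ, Matrix.trace_mul_comm]
    simp only [Matrix.mul_assoc]
    rw [Matrix.trace_mul_comm]
    simp only [Matrix.mul_assoc]
  have h2 : ((W * Wᴴ) * (β * (W * Wᴴ) * βᴴ)).trace.re ≤
      (1 * (β * (W * Wᴴ) * βᴴ)).trace.re :=
    trace_mul_re_mono hWW
      ((Matrix.posSemidef_self_mul_conjTranspose W).mul_mul_conjTranspose_same β)
  have h3 : (1 * (β * (W * Wᴴ) * βᴴ)).trace.re ≤ (β * β).trace.re := by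
    have e : (1 * (β * (W * Wᴴ) * βᴴ)).trace = ((W * Wᴴ) * (βᴴ * β)).trace := by
      rw [Matrix.one_mul, Matrix.mul_assoc, Matrix.trace_mul_comm, Matrix.mul_assoc]
    have := trace_mul_re_mono hWW (Matrix.posSemidef_conjTranspose_mul_self β)
    rw [e]
    simpa [hβ.1.eq] using this
  rw [hα.1.eq, e1] at h1
  linarith

/-- An operator-valued Cauchy-Schwarz inequality: the trace norms of `α (∑ x, δ i x • z x) β` are
controlled by the scalar quantities `∑ x, δ i x * q x' x`, where
`q x' x = Re Tr (α (z x) β (z x')*)`. -/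
lemma sq_sum_trace_le {I N : Type*} [Fintype I] [Fintype N] (δ : I → N → ℝ) {c : ℝ}
    (hc : 0 ≤ c) (hδ : ∀ i x, |δ i x| ≤ c) (z : N → Matrix ι ι ℂ) {α β : Matrix ι ι ℂ}
    (hα : α.PosSemidef) (hβ : β.PosSemidef) (hα1 : (α * α).trace.re ≤ 1)
    (hβ1 : (β * β).trace.re ≤ 1) (W : I → Matrix ι ι ℂ) (hW : ∀ i, opNorm (W i) ≤ 1)
    (e : N → ℝ)
    (he : ∀ x', ∑ i, |∑ x, δ i x * (α * z x * β * (z x')ᴴ).trace.re| ≤ e x') :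
    (∑ i, (W i * α * (∑ x, δ i x • z x) * β).trace.re) ^ 2 ≤
      Fintype.card I * (c * ∑ x', e x') := by
  set a := cfc Real.sqrt α with ha
  set b := cfc Real.sqrt β with hb
  have haa : a * a = α := cfc_sqrt_mul_self hα
  have hbb : b * b = β := cfc_sqrt_mul_self hβ
  have haH : aᴴ = a := (posSemidef_cfc_sqrt α).1.eq
  have hbH : bᴴ = b := (posSemidef_cfc_sqrt β).1.eq
  set Y : I → Matrix ι ι ℂ := fun i => ∑ x, δ i x • z x with hY
  set S := ∑ i, (W i * α * Y i * β).trace.re with hS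
  set E := ∑ i, (α * Y i * β * (Y i)ᴴ).trace.re with hE
  -- Cauchy–Schwarz through the discriminant: this quadratic in s is nonnegative, hence S² ≤ |I| E.
  have key : ∀ s : ℝ, 0 ≤ (Fintype.card I : ℝ) * (s * s) + (-2 * S) * s + E := by
    intro s
    have hi : ∀ i, 2 * (s * (W i * α * Y i * β).trace.re) ≤
        s ^ 2 * 1 + (α * Y i * β * (Y i)ᴴ).trace.re := by
      intro i
      -- The square roots a, b of α, β are shared symmetrically, so that the two squares become
      -- Tr(W* β W α) ≤ 1 and Tr(α Y β Y*).
      have h := two_mul_trace_mul_re_le (s • (b * W i * a)) (a * Y i * b)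
      have e1 : (s • (b * W i * a) * (a * Y i * b)).trace.re =
          s * (W i * α * Y i * β).trace.re := by
        rw [Matrix.smul_mul, Matrix.trace_smul, Complex.real_smul, Complex.re_ofReal_mul,
          ← haa, ← hbb]
        congr 2
        simp only [Matrix.mul_assoc]
        rw [Matrix.trace_mul_comm]
        simp only [Matrix.mul_assoc]
      have e2 : ((s • (b * W i * a)) * (s • (b * W i * a))ᴴ).trace.re =
          s ^ 2 * ((W i)ᴴ * β * W i * α).trace.re := by
        have : (b * W i * a * (b * W i * a)ᴴ).trace = ((W i)ᴴ * β * W i * α).trace := by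
          simp only [Matrix.conjTranspose_mul, haH, hbH, ← haa, ← hbb]
          rw [Matrix.trace_mul_comm]
          simp only [Matrix.mul_assoc]
          rw [Matrix.trace_mul_comm]
          simp only [Matrix.mul_assoc]
        rw [Matrix.conjTranspose_smul, Matrix.smul_mul, Matrix.mul_smul, smul_smul,
          Matrix.trace_smul, this, star_trivial, ← sq, Complex.real_smul,
          Complex.re_ofReal_mul]
      have e3 : ((a * Y i * b)ᴴ * (a * Y i * b)).trace.re =
          (α * Y i * β * (Y i)ᴴ).trace.re := by
        congr 1
        simp only [Matrix.conjTranspose_mul, haH, hbH, ← haa, ← hbb]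
        conv_rhs =>
          rw [Matrix.mul_assoc a, Matrix.mul_assoc a, Matrix.mul_assoc a, Matrix.trace_mul_comm]
        simp only [Matrix.mul_assoc]
        rw [Matrix.trace_mul_comm]
        simp only [Matrix.mul_assoc]
        rw [Matrix.trace_mul_comm]
        simp only [Matrix.mul_assoc]
        rw [Matrix.trace_mul_comm]
        simp only [Matrix.mul_assoc]
      rw [e1, e2, e3] at h
      have := trace_conj_contraction_re_le_one (hW i) hα hβ hα1 hβ1
      nlinarith [sq_nonneg s]
    have := Finset.sum_le_sum fun i (_ : i ∈ Finset.univ) => hi i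
    rw [← Finset.mul_sum, ← Finset.mul_sum, Finset.sum_add_distrib, ← hS, ← hE] at this
    simp only [Finset.sum_const, Finset.card_univ, nsmul_eq_mul] at this
    nlinarith
  have hdisc := discrim_le_zero key
  rw [discrim] at hdisc
  have hEle : E ≤ c * ∑ x', e x' := by
    have hEi : ∀ i, (α * Y i * β * (Y i)ᴴ).trace.re =
        ∑ x', δ i x' * ∑ x, δ i x * (α * z x * β * (z x')ᴴ).trace.re := by
      intro i
      simp only [hY, Matrix.conjTranspose_sum, Matrix.conjTranspose_smul, star_trivial,
        Matrix.sum_mul, Matrix.mul_smul, Matrix.smul_mul, Matrix.trace_sum,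
        Matrix.trace_smul, Complex.re_sum, Complex.real_smul, Complex.re_ofReal_mul,
        Finset.smul_sum, Finset.mul_sum]
    -- Only the coefficient of the second copy of Y i is bounded by c; the sum over x keeps its
    -- cancellation.
    calc E = ∑ x', ∑ i, δ i x' * ∑ x, δ i x * (α * z x * β * (z x')ᴴ).trace.re := by
          rw [hE, Finset.sum_comm]
          exact Finset.sum_congr rfl fun i _ => hEi i
      _ ≤ ∑ x', c * ∑ i, |∑ x, δ i x * (α * z x * β * (z x')ᴴ).trace.re| := by
          refine Finset.sum_le_sum fun x' _ => ?_
          rw [Finset.mul_sum]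
          refine Finset.sum_le_sum fun i _ => (le_abs_self _).trans ?_
          rw [abs_mul]
          exact mul_le_mul_of_nonneg_right (hδ i x') (abs_nonneg _)
      _ ≤ c * ∑ x', e x' := by
          rw [Finset.mul_sum]
          refine Finset.sum_le_sum fun x' _ => ?_
          exact mul_le_mul_of_nonneg_left (he x') hc
  have : (Fintype.card I : ℝ) * E ≤ Fintype.card I * (c * ∑ x', e x') :=
    mul_le_mul_of_nonneg_left hEle (Nat.cast_nonneg _)
  nlinarith

/-! ### Diagonal blocks and compressions -/

section Blocks

variable {N : Type*} {Q : ℕ}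

/-- The block of an element of `Mat_Q(N)` at a point of `N`. -/
def block (z : Matrix (Fin Q) (Fin Q) (N → ℂ)) (x : N) : Matrix (Fin Q) (Fin Q) ℂ :=
  z.map fun v => v x

/-- The diagonal block of a matrix at a point of `N`. -/
def diagBlock (U : Matrix (Fin Q × N) (Fin Q × N) ℂ) (x : N) : Matrix (Fin Q) (Fin Q) ℂ :=
  U.submatrix (fun i => (i, x)) (fun i => (i, x))

lemma posSemidef_diagBlock {U : Matrix (Fin Q × N) (Fin Q × N) ℂ} (hU : U.PosSemidef) (x : N) :
    (diagBlock U x).PosSemidef :=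
  hU.submatrix _

variable [DecidableEq N]

lemma diagBlock_blockEmbed (z : Matrix (Fin Q) (Fin Q) (N → ℂ)) (x : N) :
    diagBlock (blockEmbed z) x = block z x := by
  ext i j
  simp [diagBlock, blockEmbed, block]

variable [Fintype N]

/-- A diagonal block is the compression E U E* with E E* = 1. -/
lemma opNorm_diagBlock_le (U : Matrix (Fin Q × N) (Fin Q × N) ℂ) (x : N) :
    opNorm (diagBlock U x) ≤ opNorm U := by
  set E : Matrix (Fin Q) (Fin Q × N) ℂ := Matrix.of fun i p => if p = (i, x) then 1 else 0 with hE
  have hd : diagBlock U x = E * U * Eᴴ := by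
    ext i j
    simp [diagBlock, Matrix.mul_apply, hE, Matrix.conjTranspose_apply, apply_ite star]
  have hEE : E * Eᴴ = 1 := by
    ext i j
    simp [Matrix.mul_apply, hE, Matrix.conjTranspose_apply, apply_ite star, Matrix.one_apply,
      eq_comm]
  have hone : opNorm (1 : Matrix (Fin Q) (Fin Q) ℂ) ≤ 1 := by
    rcases isEmpty_or_nonempty (Fin Q) with h | h
    · rw [Subsingleton.elim (1 : Matrix (Fin Q) (Fin Q) ℂ) 0]
      open scoped Matrix.Norms.L2Operator in
      exact norm_zero.le.trans zero_le_one
    · open scoped Matrix.Norms.L2Operator in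
      exact (CStarRing.norm_one (E := Matrix (Fin Q) (Fin Q) ℂ)).le
  have hE1 : opNorm E ≤ 1 := by
    have h := Matrix.l2_opNorm_conjTranspose_mul_self Eᴴ
    change opNorm _ = opNorm _ * opNorm _ at h
    rw [Matrix.conjTranspose_conjTranspose, hEE, opNorm_conjTranspose] at h
    rw [h] at hone
    nlinarith [opNorm_nonneg E]
  calc opNorm (diagBlock U x) ≤ opNorm E * opNorm U * opNorm Eᴴ := by
        rw [hd]
        exact (opNorm_mul_le _ _).trans
          (mul_le_mul_of_nonneg_right (opNorm_mul_le _ _) (opNorm_nonneg _))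
    _ ≤ 1 * opNorm U * 1 := by
        rw [opNorm_conjTranspose]
        have := opNorm_nonneg E
        have := opNorm_nonneg U
        gcongr
    _ = opNorm U := by ring

lemma trace_mul_blockEmbed (U : Matrix (Fin Q × N) (Fin Q × N) ℂ)
    (z : Matrix (Fin Q) (Fin Q) (N → ℂ)) :
    (U * blockEmbed z).trace = ∑ x, (diagBlock U x * block z x).trace := by
  simp only [Matrix.trace, Matrix.diag, Matrix.mul_apply, blockEmbed, diagBlock, block,
    Matrix.of_apply, Matrix.submatrix_apply, Matrix.map_apply, Fintype.sum_prod_type]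
  rw [Finset.sum_comm]
  refine Finset.sum_congr rfl fun x _ => Finset.sum_congr rfl fun i _ =>
    Finset.sum_congr rfl fun j _ => ?_
  simp

lemma diagBlock_kronecker_mul (A B : Matrix (Fin Q) (Fin Q) ℂ)
    (U : Matrix (Fin Q × N) (Fin Q × N) ℂ) (x : N) :
    diagBlock ((A ⊗ₖ (1 : Matrix N N ℂ)) * U * (B ⊗ₖ (1 : Matrix N N ℂ))) x =
      A * diagBlock U x * B := by
  ext i j
  simp [diagBlock, Matrix.mul_apply, Matrix.kroneckerMap_apply, Fintype.sum_prod_type,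
    Matrix.one_apply]

end Blocks

/-! ### The matrix of Δ and the reduction to scalar vectors -/

section Coefficients

variable {N D M : Type*} [Fintype D] [Fintype M] [DecidableEq M]

/-- The matrix of `deltaS`. -/
noncomputable def deltaCoef (f : D → N → M) (p : M × D) (x : N) : ℝ :=
  (Fintype.card D : ℝ)⁻¹ * ((if f p.2 x = p.1 then 1 else 0) - (Fintype.card M : ℝ)⁻¹)

lemma inv_card_le_one (M : Type*) [Fintype M] : (Fintype.card M : ℝ)⁻¹ ≤ 1 :=
  Nat.cast_inv_le_one _

lemma abs_deltaCoef_le (f : D → N → M) (p : M × D) (x : N) :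
    |deltaCoef f p x| ≤ (Fintype.card D : ℝ)⁻¹ := by
  have h0 : (0 : ℝ) ≤ (Fintype.card M : ℝ)⁻¹ := by positivity
  have h1 := inv_card_le_one M
  rw [deltaCoef, abs_mul, abs_of_nonneg (by positivity : (0 : ℝ) ≤ (Fintype.card D : ℝ)⁻¹)]
  refine mul_le_of_le_one_right (by positivity) ?_
  split_ifs <;> rw [abs_le] <;> constructor <;> linarith

/-- A column of Δ is the difference of two probability vectors. This gives the trivial bound ‖Δ‖ ≤ 2
on ℓ₁, used wherever the hypothesis on the extractor does not help. -/
lemma sum_abs_deltaCoef_le [Nonempty D] [Nonempty M] (f : D → N → M) (x : N) :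
    ∑ p, |deltaCoef f p x| ≤ 2 := by
  have hD : (Fintype.card D : ℝ) ≠ 0 := by simp
  have hM : (Fintype.card M : ℝ) ≠ 0 := by simp
  calc ∑ p, |deltaCoef f p x|
      ≤ ∑ p : M × D, (Fintype.card D : ℝ)⁻¹ *
          ((if f p.2 x = p.1 then 1 else 0) + (Fintype.card M : ℝ)⁻¹) := by
        refine Finset.sum_le_sum fun p _ => ?_
        have h0 : (0 : ℝ) ≤ (Fintype.card M : ℝ)⁻¹ := by positivity
        rw [deltaCoef, abs_mul, abs_of_nonneg (by positivity : (0 : ℝ) ≤ (Fintype.card D : ℝ)⁻¹)]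
        refine mul_le_mul_of_nonneg_left ?_ (by positivity)
        split_ifs <;> rw [abs_le] <;> constructor <;> linarith
    _ = 2 := by
        rw [← Finset.mul_sum, Fintype.sum_prod_type_right]
        simp only [Finset.sum_add_distrib, Finset.sum_ite_eq, Finset.mem_univ, if_true,
          Finset.sum_const, Finset.card_univ, nsmul_eq_mul]
        field_simp
        norm_num

variable [Fintype N]

lemma push_apply {𝕜 N M : Type*} [RCLike 𝕜] [Fintype N] [DecidableEq M]
    (g : N → M) (P : N → 𝕜) (y : M) :
    push 𝕜 g P y = ∑ x, (if g x = y then 1 else 0) * P x := rfl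

lemma deltaS_apply {𝕜 : Type*} [RCLike 𝕜] (f : D → N → M) (P : N → 𝕜) (p : M × D) :
    deltaS 𝕜 f P p = ∑ x, (deltaCoef f p x : 𝕜) * P x := by
  change (Fintype.card D : 𝕜)⁻¹ * push 𝕜 (f p.2) P p.1
    - (∑ x, P x) * ((Fintype.card M : 𝕜)⁻¹ * (Fintype.card D : 𝕜)⁻¹) = _
  rw [push_apply, Finset.mul_sum, Finset.sum_mul, ← Finset.sum_sub_distrib]
  refine Finset.sum_congr rfl fun x _ => ?_
  rw [deltaCoef]
  push_cast
  split_ifs <;> simp <;> ring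

lemma sum_abs_sum_deltaCoef_le [Nonempty D] [Nonempty M] (f : D → N → M) (q : N → ℝ) :
    ∑ p, |∑ x, deltaCoef f p x * q x| ≤ 2 * ∑ x, |q x| := by
  calc ∑ p, |∑ x, deltaCoef f p x * q x| ≤ ∑ p, ∑ x, |deltaCoef f p x| * |q x| := by
        refine Finset.sum_le_sum fun p _ => (Finset.abs_sum_le_sum_abs _ _).trans ?_
        simp only [abs_mul, le_refl]
    _ = ∑ x, (∑ p, |deltaCoef f p x|) * |q x| := by
        rw [Finset.sum_comm]
        simp only [Finset.sum_mul]
    _ ≤ 2 * ∑ x, |q x| := by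
        rw [Finset.mul_sum]
        exact Finset.sum_le_sum fun x _ =>
          mul_le_mul_of_nonneg_right (sum_abs_deltaCoef_le f x) (abs_nonneg _)

lemma block_map_deltaS {Q : ℕ} (f : D → N → M) (z : Matrix (Fin Q) (Fin Q) (N → ℂ))
    (p : M × D) :
    block (z.map (deltaS ℂ f)) p = ∑ x, deltaCoef f p x • block z x := by
  ext i j
  rw [Matrix.sum_apply]
  simp only [block, Matrix.map_apply, deltaS_apply, Matrix.smul_apply, Complex.real_smul]
  rfl

lemma block_map_push_sub {Q : ℕ} [Nonempty D] (f : D → N → M)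
    (z : Matrix (Fin Q) (Fin Q) (N → ℂ)) (y : M) (s : D) :
    block (z.map (push ℂ (f s)) - tensorUniform M (marginal z)) y =
      (Fintype.card D : ℝ) • ∑ x, deltaCoef f (y, s) x • block z x := by
  have hD : (Fintype.card D : ℝ) ≠ 0 := by simp
  ext i j
  rw [Matrix.smul_apply, Matrix.sum_apply]
  simp only [block, Matrix.map_apply, Matrix.sub_apply, Pi.sub_apply, push_apply, tensorUniform,
    marginal, Matrix.smul_apply, Finset.smul_sum, Finset.sum_mul, ← Finset.sum_sub_distrib]
  refine Finset.sum_congr rfl fun x _ => ?_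
  rw [smul_smul, deltaCoef, mul_inv_cancel_left₀ hD, Complex.real_smul]
  split_ifs <;> push_cast <;> ring

/-- The form of Cauchy–Schwarz used for both parts: w carries the dependence on x', η is the
classical bound for one vector, ω the total weight. -/
lemma sum_trace_deltaCoef_le [Nonempty D] {ι : Type*} [Fintype ι] [DecidableEq ι]
    (f : D → N → M) (z : N → Matrix ι ι ℂ) {α β : Matrix ι ι ℂ}
    (hα : α.PosSemidef) (hβ : β.PosSemidef) (hα1 : (α * α).trace.re ≤ 1)
    (hβ1 : (β * β).trace.re ≤ 1) (W : M × D → Matrix ι ι ℂ) (hW : ∀ p, opNorm (W p) ≤ 1)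
    (w : N → ℝ) {η ω : ℝ} (hη : 0 ≤ η) (hω : ∑ x, w x ≤ ω)
    (hw : ∀ x', ∑ p, |∑ x, deltaCoef f p x * (α * z x * β * (z x')ᴴ).trace.re| ≤ η * w x') :
    ∑ p, (W p * α * (∑ x, deltaCoef f p x • z x) * β).trace.re ≤
      Real.sqrt (Fintype.card M * (η * ω)) := by
  have hD : (Fintype.card D : ℝ) ≠ 0 := by simp
  refine Real.le_sqrt_of_sq_le ((sq_sum_trace_le (deltaCoef f) (by positivity)
    (abs_deltaCoef_le f) z hα hβ hα1 hβ1 W hW (fun x => η * w x) hw).trans ?_)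
  -- There are M·D indices and each coefficient is at most 1/D, so the seed disappears and only M
  -- survives.
  rw [Fintype.card_prod, ← Finset.mul_sum]
  push_cast
  rw [mul_assoc, mul_inv_cancel_left₀ hD]
  gcongr

end Coefficients

/-! ### Trace estimates for factorized families -/

section Families

lemma posSemidef_mul_mul_self {ι : Type*} [Fintype ι] {α A : Matrix ι ι ℂ}
    (hα : α.PosSemidef) (hA : A.PosSemidef) :
    (α * A * α).PosSemidef := by
  simpa [hα.1.eq] using hA.mul_mul_conjTranspose_same α

/-- By cyclicity the trace on the left is that of (a'* α a)(b* β b'); the arithmetic-geometric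
inequality then separates the a-factors from the b-factors. -/
lemma two_mul_abs_trace_factor_re_le {ι κ : Type*} [Fintype ι] [Fintype κ] {α β : Matrix ι ι ℂ}
    (hα : α.PosSemidef) (hβ : β.PosSemidef) (a b a' b' : Matrix ι κ ℂ) :
    2 * |(α * (a * bᴴ) * β * (a' * b'ᴴ)ᴴ).trace.re| ≤
      (α * (a' * a'ᴴ) * α * (a * aᴴ)).trace.re + (β * (b' * b'ᴴ) * β * (b * bᴴ)).trace.re := by
  have h := two_mul_abs_trace_mul_re_le (a'ᴴ * α * a) (bᴴ * β * b')
  have e1 : (a'ᴴ * α * a * (bᴴ * β * b')).trace = (α * (a * bᴴ) * β * (a' * b'ᴴ)ᴴ).trace := by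
    simp only [Matrix.conjTranspose_mul, Matrix.conjTranspose_conjTranspose, Matrix.mul_assoc]
    rw [Matrix.trace_mul_comm]
    simp only [Matrix.mul_assoc]
  have e2 : (a'ᴴ * α * a * (a'ᴴ * α * a)ᴴ).trace = (α * (a' * a'ᴴ) * α * (a * aᴴ)).trace := by
    simp only [Matrix.conjTranspose_mul, Matrix.conjTranspose_conjTranspose, Matrix.mul_assoc,
      hα.1.eq]
    rw [Matrix.trace_mul_comm]
    simp only [Matrix.mul_assoc]
    rw [Matrix.trace_mul_comm]
    simp only [Matrix.mul_assoc]
    rw [Matrix.trace_mul_comm]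
    simp only [Matrix.mul_assoc]
    rw [Matrix.trace_mul_comm]
    simp only [Matrix.mul_assoc]
  have e3 : ((bᴴ * β * b')ᴴ * (bᴴ * β * b')).trace =
      (β * (b' * b'ᴴ) * β * (b * bᴴ)).trace := by
    simp only [Matrix.conjTranspose_mul, Matrix.conjTranspose_conjTranspose, Matrix.mul_assoc,
      hβ.1.eq]
    rw [Matrix.trace_mul_comm]
    simp only [Matrix.mul_assoc]
    rw [Matrix.trace_mul_comm]
    simp only [Matrix.mul_assoc]
    rw [Matrix.trace_mul_comm]
    simp only [Matrix.mul_assoc]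
    rw [Matrix.trace_mul_comm]
    simp only [Matrix.mul_assoc]
  rwa [e1, e2, e3] at h

variable {N : Type*} [Fintype N]

lemma trace_mul_smul_one_re (P : Matrix ι ι ℂ) (t : ℝ) :
    (P * (t • (1 : Matrix ι ι ℂ))).trace.re = t * P.trace.re := by
  rw [Matrix.mul_smul, Matrix.mul_one, Matrix.trace_smul, Complex.real_smul,
    Complex.re_ofReal_mul]

lemma trace_mul_re_le_of_le_smul_one {P A : Matrix ι ι ℂ} (hP : P.PosSemidef) {t : ℝ}
    (hA : (t • (1 : Matrix ι ι ℂ) - A).PosSemidef) : (P * A).trace.re ≤ t * P.trace.re := by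
  rw [← trace_mul_smul_one_re]
  exact trace_mul_re_mono' hA hP

lemma sum_trace_conj_re_le {α : Matrix ι ι ℂ} (hα : α.PosSemidef)
    (hα1 : (α * α).trace.re ≤ 1) (A : N → Matrix ι ι ℂ) {t : ℝ} (ht : 0 ≤ t)
    (hA : (t • (1 : Matrix ι ι ℂ) - ∑ x, A x).PosSemidef) :
    ∑ x, (α * A x * α).trace.re ≤ t := by
  have h := trace_mul_re_le_of_le_smul_one
    (by simpa [hα.1.eq] using Matrix.posSemidef_self_mul_conjTranspose α : (α * α).PosSemidef) hA
  have e : ∀ x, (α * A x * α).trace.re = (α * α * A x).trace.re := fun x => by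
    rw [Matrix.trace_mul_comm, Matrix.mul_assoc]
  simp only [e]
  rw [← Complex.re_sum, ← Matrix.trace_sum, ← Finset.mul_sum]
  nlinarith

end Families

/-- Homogeneous form of the norm hypothesis, tested only on real vectors; this is why real and
complex scalars serve equally. -/
lemma sum_abs_deltaCoef_le_of_boundedNorm {𝕜 N D M : Type*} [RCLike 𝕜] [Fintype N] [Fintype D]
    [Fintype M] [DecidableEq M] (f : D → N → M) {K ε : ℝ}
    (hε : 0 < ε)
    (h : boundedNorm (fun P => ENNReal.ofReal (capNorm K P))
      (fun R => ENNReal.ofReal (l1Norm R)) (deltaS 𝕜 f) ≤ ENNReal.ofReal ε)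
    (hK : 0 ≤ K) (q : N → ℝ) (L : ℝ) (hL : 0 ≤ L) (hq : ∀ x, K * |q x| ≤ L)
    (hq1 : ∑ x, |q x| ≤ L) : ∑ p, |∑ x, deltaCoef f p x * q x| ≤ ε * L := by
  rcases hL.eq_or_lt with h0 | h0
  · have hz : ∀ x, q x = 0 := fun x => by
      have := (Finset.sum_eq_zero_iff_of_nonneg fun x _ => abs_nonneg (q x)).mp
        (le_antisymm (hq1.trans h0.ge) (Finset.sum_nonneg fun x _ => abs_nonneg _)) x
        (Finset.mem_univ x)
      exact abs_eq_zero.mp this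
    simp [hz, ← h0]
  set P : N → 𝕜 := fun x => ((q x / L : ℝ) : 𝕜) with hP
  have hn : ∀ x, ‖P x‖ = |q x| / L := fun x => by
    simp only [hP]
    rw [RCLike.norm_ofReal, abs_div, abs_of_pos h0]
  have hcap : capNorm K P ≤ 1 := by
    refine max_le ?_ ?_
    · rcases hK.eq_or_lt with hK0 | hK0
      · simp [← hK0]
      · rw [← le_div_iff₀' hK0, linftyNorm, pi_norm_le_iff_of_nonneg (by positivity)]
        intro x
        rw [hn, div_le_div_iff₀ h0 hK0]
        linarith [hq x]
    · simp only [l1Norm, hn]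
      rwa [← Finset.sum_div, div_le_one h0]
  have h1 : ENNReal.ofReal (l1Norm (deltaS 𝕜 f P)) ≤ ENNReal.ofReal ε :=
    le_trans (le_iSup₂_of_le P (by
      simpa using hcap) le_rfl) h
  rw [ENNReal.ofReal_le_ofReal_iff hε.le] at h1
  have e : l1Norm (deltaS 𝕜 f P) = (∑ p, |∑ x, deltaCoef f p x * q x|) / L := by
    rw [l1Norm, Finset.sum_div]
    refine Finset.sum_congr rfl fun p _ => ?_
    have : deltaS 𝕜 f P p = (((∑ x, deltaCoef f p x * q x) / L : ℝ) : 𝕜) := by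
      rw [deltaS_apply, Finset.sum_div]
      push_cast
      refine Finset.sum_congr rfl fun x _ => ?_
      simp only [hP]
      push_cast
      ring
    rw [this, RCLike.norm_ofReal, abs_div, abs_of_pos h0]
  rwa [e, div_le_iff₀ h0] at h1

/-! ### Part (a): factorizations and the completely bounded norm -/

section Factors

variable {N : Type*} [Fintype N] {Q : ℕ}

/-- The block of rows of a matrix at a point of `N`. -/
def rowBlock (a : Matrix (Fin Q × N) (Fin Q × N) ℂ) (x : N) : Matrix (Fin Q) (Fin Q × N) ℂ :=
  a.submatrix (fun i => (i, x)) id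

lemma rowBlock_mul_conjTranspose (a b : Matrix (Fin Q × N) (Fin Q × N) ℂ) (x : N) :
    rowBlock a x * (rowBlock b x)ᴴ = diagBlock (a * bᴴ) x := rfl

/-- Turns the Γ term of the factor norm into an upper bound for the sum of the positive matrices a_x
a_x*, the operator analogue of an ℓ₁ bound. -/
lemma Gam_mul_conjTranspose (a : Matrix (Fin Q × N) (Fin Q × N) ℂ) :
    Gam a * (Gam a)ᴴ = ∑ x, rowBlock a x * (rowBlock a x)ᴴ := by
  ext i j
  rw [Matrix.sum_apply]
  simp only [Matrix.mul_apply, Matrix.conjTranspose_apply, Gam, rowBlock, Matrix.of_apply,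
    Matrix.submatrix_apply, Fintype.sum_prod_type, id]
  rw [Finset.sum_comm]

variable [DecidableEq N]

lemma posSemidef_smul_one_sub_rowBlock (a : Matrix (Fin Q × N) (Fin Q × N) ℂ) {s : ℝ}
    (hs : opNorm a ≤ s) (x : N) :
    (s ^ 2 • (1 : Matrix (Fin Q) (Fin Q) ℂ) - rowBlock a x * (rowBlock a x)ᴴ).PosSemidef := by
  have h := posSemidef_diagBlock (posSemidef_sq_smul_one_sub a hs) x
  have e : diagBlock (s ^ 2 • (1 : Matrix (Fin Q × N) (Fin Q × N) ℂ) - a * aᴴ) x =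
      s ^ 2 • (1 : Matrix (Fin Q) (Fin Q) ℂ) - rowBlock a x * (rowBlock a x)ᴴ := by
    rw [rowBlock_mul_conjTranspose]
    ext i j
    simp [diagBlock, Matrix.one_apply]
  rwa [e] at h

variable {D M : Type*} [Fintype D] [DecidableEq D] [Fintype M] [DecidableEq M]

/-- If `deltaS` is small on real vectors in the unit ball of `∩{2^k ℓ_∞, ℓ₁}`, it is small
on factorizable elements. -/
lemma traceNorm_deltaS_le_of_factor [Nonempty D] [Nonempty M] (f : D → N → M) {k ε : ℝ}
    (hε : 0 < ε)
    (H : ∀ (q : N → ℝ) (L : ℝ), 0 ≤ L → (∀ x, (2 : ℝ) ^ k * |q x| ≤ L) → ∑ x, |q x| ≤ L →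
      ∑ p, |∑ x, deltaCoef f p x * q x| ≤ ε * L)
    (z : Matrix (Fin Q) (Fin Q) (N → ℂ)) (a b : Matrix (Fin Q × N) (Fin Q × N) ℂ)
    (hz : blockEmbed z = a * bᴴ) {r : ℝ}
    (ha : factorNorm ((2 : ℝ) ^ k / ε) a ≤ r) (hb : factorNorm ((2 : ℝ) ^ k / ε) b ≤ r)
    (A B : Matrix (Fin Q) (Fin Q) ℂ) (hA : hsNorm A ≤ 1) (hB : hsNorm B ≤ 1) :
    traceNorm ((A ⊗ₖ (1 : Matrix (M × D) (M × D) ℂ)) * blockEmbed (z.map (deltaS ℂ f)) *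
      (B ⊗ₖ (1 : Matrix (M × D) (M × D) ℂ))) ≤ r ^ 2 * Real.sqrt (Fintype.card M * (2 * ε)) := by
  -- The number s below bounds the operator norms of a and b; hence a_x a_x* and b_x b_x* are at
  -- most s² = r² ε / 2^k.
  have h2k : (0 : ℝ) < (2 : ℝ) ^ k := by positivity
  set s := r / Real.sqrt ((2 : ℝ) ^ k / ε) with hs
  have hK : 0 < Real.sqrt ((2 : ℝ) ^ k / ε) := by positivity
  have hs2 : s ^ 2 = r ^ 2 * ε / (2 : ℝ) ^ k := by
    rw [hs, div_pow, Real.sq_sqrt (by positivity)]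
    field_simp
  have split : ∀ c : Matrix (Fin Q × N) (Fin Q × N) ℂ,
      factorNorm ((2 : ℝ) ^ k / ε) c ≤ r → opNorm c ≤ s ∧ opNorm (Gam c) ≤ r := fun c hc => by
    obtain ⟨h1, h2⟩ := max_le_iff.mp hc
    refine ⟨?_, h2⟩
    rw [hs, le_div_iff₀ hK]
    linarith
  have hsum : ∀ c : Matrix (Fin Q × N) (Fin Q × N) ℂ, opNorm (Gam c) ≤ r →
      (r ^ 2 • (1 : Matrix (Fin Q) (Fin Q) ℂ) -
        ∑ x, rowBlock c x * (rowBlock c x)ᴴ).PosSemidef := fun c hc => by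
    rw [← Gam_mul_conjTranspose]
    exact posSemidef_sq_smul_one_sub _ hc
  obtain ⟨V, hV, hAV, -⟩ := exists_polar A
  obtain ⟨V', hV', hBV, -⟩ := exists_polar Bᴴ
  have hα := posSemidef_cfc_sqrt (Aᴴ * A)
  have hβ := posSemidef_cfc_sqrt (Bᴴᴴ * Bᴴ)
  have hαα := cfc_sqrt_mul_self (Matrix.posSemidef_conjTranspose_mul_self A)
  have hββ := cfc_sqrt_mul_self (Matrix.posSemidef_conjTranspose_mul_self Bᴴ)
  set α := cfc Real.sqrt (Aᴴ * A)
  set β := cfc Real.sqrt (Bᴴᴴ * Bᴴ)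
  have hα1 : (α * α).trace.re ≤ 1 := by
    rw [hαα]
    simpa using (Real.sqrt_le_iff.mp hA).2
  have hβ1 : (β * β).trace.re ≤ 1 := by
    rw [hββ, Matrix.conjTranspose_conjTranspose, Matrix.trace_mul_comm]
    simpa using (Real.sqrt_le_iff.mp hB).2
  have hBβ : B = β * V'ᴴ := by
    rw [← hβ.1.eq, ← Matrix.conjTranspose_mul, ← hBV, Matrix.conjTranspose_conjTranspose]
  obtain ⟨U, hU, hUX⟩ := exists_traceNorm_eq ((A ⊗ₖ (1 : Matrix (M × D) (M × D) ℂ)) *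
    blockEmbed (z.map (deltaS ℂ f)) * (B ⊗ₖ (1 : Matrix (M × D) (M × D) ℂ)))
  -- These weights are the traces left when a_x a_x* and b_x b_x* are replaced by multiples of the
  -- identity; they sum to at most r².
  set w : N → ℝ := fun x => ((α * (rowBlock a x * (rowBlock a x)ᴴ) * α).trace.re +
    (β * (rowBlock b x * (rowBlock b x)ᴴ) * β).trace.re) / 2 with hw
  have hzx : ∀ x, block z x = rowBlock a x * (rowBlock b x)ᴴ := fun x => by
    rw [rowBlock_mul_conjTranspose, ← hz, diagBlock_blockEmbed]
  -- With A = V α and B = β V'*, the partial isometries are absorbed into the dual contraction U, so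
  -- that W_p = V'* U_p V.
  have htr : traceNorm ((A ⊗ₖ (1 : Matrix (M × D) (M × D) ℂ)) *
      blockEmbed (z.map (deltaS ℂ f)) * (B ⊗ₖ (1 : Matrix (M × D) (M × D) ℂ))) =
      ∑ p, (V'ᴴ * diagBlock U p * V * α * (∑ x, deltaCoef f p x • block z x) * β).trace.re := by
    rw [hUX, ← Matrix.mul_assoc, Matrix.trace_mul_comm, ← Matrix.mul_assoc, ← Matrix.mul_assoc,
      trace_mul_blockEmbed, Complex.re_sum]
    refine Finset.sum_congr rfl fun p _ => ?_
    rw [diagBlock_kronecker_mul, block_map_deltaS]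
    nth_rewrite 1 [hBβ]
    nth_rewrite 1 [hAV]
    rw [Matrix.mul_assoc β, Matrix.mul_assoc β, Matrix.mul_assoc β, Matrix.trace_mul_comm]
    simp only [Matrix.mul_assoc]
  have hpos : ∀ (c : Matrix (Fin Q × N) (Fin Q × N) ℂ) (x : N),
      (rowBlock c x * (rowBlock c x)ᴴ).PosSemidef := fun c x =>
    Matrix.posSemidef_self_mul_conjTranspose _
  have hw0 : ∀ x, 0 ≤ w x := fun x => by
    have h1 := (Complex.le_def.mp (posSemidef_mul_mul_self hα (hpos a x)).trace_nonneg).1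
    have h2 := (Complex.le_def.mp (posSemidef_mul_mul_self hβ (hpos b x)).trace_nonneg).1
    rw [Complex.zero_re] at h1 h2
    simp only [hw]
    linarith
  have hwsum : ∑ x, w x ≤ r ^ 2 := by
    simp only [hw]
    rw [← Finset.sum_div, Finset.sum_add_distrib]
    have h1 := sum_trace_conj_re_le hα hα1 _ (sq_nonneg r) (hsum a (split a ha).2)
    have h2 := sum_trace_conj_re_le hβ hβ1 _ (sq_nonneg r) (hsum b (split b hb).2)
    linarith
  have hbound : ∀ x', ∑ p, |∑ x, deltaCoef f p x *
      (α * block z x * β * (block z x')ᴴ).trace.re| ≤ (r ^ 2 * (2 * ε)) * w x' := by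
    intro x'
    set q : N → ℝ := fun x => (α * block z x * β * (block z x')ᴴ).trace.re with hq
    have hq2 : ∀ x, 2 * |q x| ≤
        (α * (rowBlock a x' * (rowBlock a x')ᴴ) * α *
          (rowBlock a x * (rowBlock a x)ᴴ)).trace.re +
        (β * (rowBlock b x' * (rowBlock b x')ᴴ) * β *
          (rowBlock b x * (rowBlock b x)ᴴ)).trace.re := fun x => by
      simp only [hq, hzx]
      exact two_mul_abs_trace_factor_re_le hα hβ _ _ _ _
    have hPa := posSemidef_mul_mul_self hα (hpos a x')
    have hPb := posSemidef_mul_mul_self hβ (hpos b x')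
    have hmax : ∀ x, |q x| ≤ s ^ 2 * w x' := fun x => by
      have h1 := trace_mul_re_le_of_le_smul_one hPa
        (posSemidef_smul_one_sub_rowBlock a (split a ha).1 x)
      have h2 := trace_mul_re_le_of_le_smul_one hPb
        (posSemidef_smul_one_sub_rowBlock b (split b hb).1 x)
      have := hq2 x
      simp only [hw]
      linarith
    have hone : ∑ x, |q x| ≤ r ^ 2 * w x' := by
      have h1 := trace_mul_re_le_of_le_smul_one hPa (hsum a (split a ha).2)
      have h2 := trace_mul_re_le_of_le_smul_one hPb (hsum b (split b hb).2)
      rw [Finset.mul_sum, Matrix.trace_sum, Complex.re_sum] at h1 h2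
      have := Finset.sum_le_sum fun x (_ : x ∈ Finset.univ) => hq2 x
      rw [← Finset.mul_sum, Finset.sum_add_distrib] at this
      simp only [hw]
      linarith
    have hrw : 0 ≤ r ^ 2 * w x' := mul_nonneg (sq_nonneg r) (hw0 x')
    -- For ε ≤ 1 the sup condition holds with a factor ε to spare. For ε ≥ 1 it may fail, but ‖Δ‖ ≤
    -- 2 ≤ 2ε; this case produces the 2 in 2ε.
    rcases le_total ε 1 with h | h
    · have := H q (r ^ 2 * w x') hrw (fun x => ?_) hone
      · nlinarith
      · have := mul_le_mul_of_nonneg_left (hmax x) h2k.le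
        rw [hs2] at this
        have e : (2 : ℝ) ^ k * (r ^ 2 * ε / (2 : ℝ) ^ k * w x') = ε * (r ^ 2 * w x') := by
          field_simp
        rw [e] at this
        nlinarith
    · have := sum_abs_sum_deltaCoef_le f q
      nlinarith
  rw [htr]
  refine (sum_trace_deltaCoef_le f (block z) hα hβ hα1 hβ1
    (fun p => V'ᴴ * diagBlock U p * V) (fun p => ?_) w (by positivity) hwsum hbound).trans ?_
  · exact opNorm_mul_le_one (opNorm_mul_le_one (by rwa [opNorm_conjTranspose])
      ((opNorm_diagBlock_le U p).trans hU)) hV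
  · have e : (Fintype.card M : ℝ) * (r ^ 2 * (2 * ε) * r ^ 2) =
        (r ^ 2) ^ 2 * (Fintype.card M * (2 * ε)) := by ring
    rw [e, Real.sqrt_mul (by positivity), Real.sqrt_sq (by positivity)]

lemma opNorm_smul {ι κ : Type*} [Fintype ι] [Fintype κ] [DecidableEq κ] {t : ℝ} (ht : 0 ≤ t)
    (c : Matrix ι κ ℂ) : opNorm (t • c) = t * opNorm c := by
  have e : t • c = (t : ℂ) • c := by
    ext i j
    simp
  rw [e]
  open scoped Matrix.Norms.L2Operator in
  exact (norm_smul (t : ℂ) c).trans (by rw [Complex.norm_real, Real.norm_of_nonneg ht]; rfl)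

lemma factorNorm_smul {t : ℝ} (ht : 0 ≤ t) (K : ℝ) (a : Matrix (Fin Q × N) (Fin Q × N) ℂ) :
    factorNorm K (t • a) = t * factorNorm K a := by
  have hG : Gam (t • a) = t • Gam a := rfl
  rw [factorNorm, factorNorm, hG, opNorm_smul ht, opNorm_smul ht, mul_max_of_nonneg _ _ ht]
  ring_nf

lemma factorNorm_nonneg (K : ℝ) (a : Matrix (Fin Q × N) (Fin Q × N) ℂ) : 0 ≤ factorNorm K a :=
  (opNorm_nonneg _).trans (le_max_right _ _)

lemma cbNorm_deltaS_le [Nonempty D] [Nonempty M] (f : D → N → M) {k ε : ℝ}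
    (hε : 0 < ε)
    (H : ∀ (q : N → ℝ) (L : ℝ), 0 ≤ L → (∀ x, (2 : ℝ) ^ k * |q x| ≤ L) → ∑ x, |q x| ≤ L →
      ∑ p, |∑ x, deltaCoef f p x * q x| ≤ ε * L) :
    cbNorm (capcapNorm ((2 : ℝ) ^ k / ε)) l1OpNorm (deltaS ℂ f) ≤
      ENNReal.ofReal (2 * Real.sqrt (Fintype.card M * (2 * ε))) := by
  refine iSup_le fun Q => iSup_le fun z => iSup_le fun hz => ?_
  -- The infimum over factorizations need not be attained, so one of cost below 2 is taken; this
  -- slack is the factor 2 in the bound.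
  have hlt : capcapNorm ((2 : ℝ) ^ k / ε) Q z < ENNReal.ofReal 2 :=
    hz.trans_lt (by rw [ENNReal.one_lt_ofReal]; norm_num)
  simp only [capcapNorm, capcapMat, iInf_lt_iff] at hlt
  obtain ⟨a, b, hab, hlt⟩ := hlt
  rw [ENNReal.ofReal_lt_ofReal_iff two_pos] at hlt
  set K := (2 : ℝ) ^ k / ε
  have ha0 := factorNorm_nonneg K a
  have hb0 := factorNorm_nonneg K b
  set r := Real.sqrt 2
  have hr0 : 0 < r := by positivity
  have hrr : r * r = 2 := Real.mul_self_sqrt zero_le_two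
  -- Replacing (a, b) by (t a, t⁻¹ b) balances the factors at √2 each; a factor a of norm zero needs
  -- its own t.
  obtain ⟨t, ht, hta, htb⟩ : ∃ t : ℝ, 0 < t ∧ t * factorNorm K a ≤ r ∧
      t⁻¹ * factorNorm K b ≤ r := by
    rcases ha0.eq_or_lt with h | h
    · refine ⟨(factorNorm K b + 1) / r, by positivity, by rw [← h]; simpa using hr0.le, ?_⟩
      rw [inv_div, div_mul_eq_mul_div, div_le_iff₀ (by positivity)]
      nlinarith
    · refine ⟨r / factorNorm K a, by positivity, by rw [div_mul_cancel₀ _ h.ne'], ?_⟩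
      rw [inv_div, div_mul_eq_mul_div, div_le_iff₀ hr0]
      linarith
  refine iSup_le fun A => iSup_le fun B => iSup_le fun hA => iSup_le fun hB =>
    ENNReal.ofReal_le_ofReal ?_
  have h := traceNorm_deltaS_le_of_factor (r := r) f hε H z (t • a) (t⁻¹ • b) ?_
    (by rwa [factorNorm_smul ht.le]) (by rwa [factorNorm_smul (inv_nonneg.mpr ht.le)]) A B hA hB
  · rwa [sq, hrr] at h
  · rw [hab, Matrix.conjTranspose_smul, star_trivial, Matrix.smul_mul, Matrix.mul_smul,
      smul_smul, mul_inv_cancel₀ ht.ne', one_smul]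

end Factors

/-! ### Classical extractors on unnormalized nonnegative vectors -/

section Scalar

variable {N D M : Type*} [Fintype N] [Fintype D] [Fintype M] [DecidableEq M]

lemma sum_abs_deltaCoef_eq [Nonempty D] (f : D → N → M) (P : N → ℝ) (hP : ∑ x, P x = 1) :
    ∑ p, |∑ x, deltaCoef f p x * P x| = (Fintype.card D : ℝ)⁻¹ *
      ∑ s, l1Norm (push ℝ (f s) P - fun _ => (Fintype.card M : ℝ)⁻¹) := by
  rw [Fintype.sum_prod_type_right, Finset.mul_sum]
  refine Finset.sum_congr rfl fun s _ => ?_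
  rw [l1Norm, Finset.mul_sum]
  refine Finset.sum_congr rfl fun y _ => ?_
  have e : ∑ x, deltaCoef f (y, s) x * P x = (Fintype.card D : ℝ)⁻¹ *
      (push ℝ (f s) P - fun _ => (Fintype.card M : ℝ)⁻¹ : M → ℝ) y := by
    have hM : (Fintype.card M : ℝ)⁻¹ = ∑ x, (Fintype.card M : ℝ)⁻¹ * P x := by
      rw [← Finset.mul_sum, hP, mul_one]
    rw [Pi.sub_apply, push_apply, hM, ← Finset.sum_sub_distrib, Finset.mul_sum]
    refine Finset.sum_congr rfl fun x _ => ?_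
    rw [deltaCoef]
    ring
  rw [e, abs_mul, abs_of_nonneg (by positivity), Real.norm_eq_abs]

lemma IsStrongExtractor.sum_abs_deltaCoef_le [Nonempty D] [Nonempty M] {f : D → N → M}
    {k ε : ℝ} (h : IsStrongExtractor f k ε) (hε : 0 < ε) (q : N → ℝ) (hq : ∀ x, 0 ≤ q x) {w : ℝ}
    (hw : 0 ≤ w) (hqw : ∀ x, q x ≤ 3 * (ε * (2 : ℝ) ^ (-k)) * w) (hsum : ∑ x, q x ≤ 3 * w) :
    ∑ p, |∑ x, deltaCoef f p x * q x| ≤ 6 * ε * w := by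
  have hS0 : 0 ≤ ∑ x, q x := Finset.sum_nonneg fun x _ => hq x
  set S := ∑ x, q x with hS
  have htriv : ∑ p, |∑ x, deltaCoef f p x * q x| ≤ 2 * S := by
    refine (sum_abs_sum_deltaCoef_le f q).trans_eq ?_
    simp only [abs_of_nonneg (hq _), hS]
  have hεw : 0 ≤ ε * w := by positivity
  -- A mass of at most 3εw is handled by ‖Δ‖ ≤ 2, whence 6εw. Above that threshold q / S is bounded
  -- by 2^(-k), so the extractor property applies and gives εS ≤ 3εw.
  by_cases hcase : S ≤ 3 * ε * w
  · linarith
  have hSpos : 0 < S := by nlinarith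
  have hsum1 : ∑ x, q x / S = 1 := by rw [← Finset.sum_div, div_self hSpos.ne']
  have hle : linftyNorm (fun x => q x / S) ≤ (2 : ℝ) ^ (-k) := by
    rw [linftyNorm, pi_norm_le_iff_of_nonneg (by positivity)]
    intro x
    rw [Real.norm_of_nonneg (div_nonneg (hq x) hS0), div_le_iff₀ hSpos]
    have h2 : (0 : ℝ) < (2 : ℝ) ^ (-k) := by positivity
    have := hqw x
    nlinarith
  have hpos : 0 < linftyNorm (fun x => q x / S) := by
    rw [linftyNorm, norm_pos_iff]
    intro h0
    rw [Finset.sum_eq_zero fun x _ => congrFun h0 x] at hsum1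
    exact zero_ne_one hsum1
  have hent : k ≤ minEntropy (fun x => q x / S) := by
    rw [minEntropy, le_neg, Real.logb_le_iff_le_rpow one_lt_two hpos]
    exact hle
  have h1 := h (fun x => q x / S) (fun x => div_nonneg (hq x) hS0) hsum1 hent
  rw [← sum_abs_deltaCoef_eq f _ hsum1] at h1
  have e : ∑ p, |∑ x, deltaCoef f p x * (q x / S)| =
      (∑ p, |∑ x, deltaCoef f p x * q x|) / S := by
    rw [Finset.sum_div]
    refine Finset.sum_congr rfl fun p _ => ?_
    simp only [← mul_div_assoc]
    rw [← Finset.sum_div, abs_div, abs_of_pos hSpos]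
  rw [e, div_le_iff₀ hSpos] at h1
  nlinarith

end Scalar

/-! ### Part (b): classical-quantum states and min-entropy -/

section States

variable {N : Type*} [Fintype N] [DecidableEq N] {Q : ℕ}

lemma IsCQState.posSemidef_block {ρ : Matrix (Fin Q) (Fin Q) (N → ℂ)} (h : IsCQState ρ) (x : N) :
    (block ρ x).PosSemidef := by
  rw [← diagBlock_blockEmbed]
  exact posSemidef_diagBlock h.1 x

lemma marginal_eq_sum_block {N : Type*} [Fintype N] (ρ : Matrix (Fin Q) (Fin Q) (N → ℂ)) :
    marginal ρ = ∑ x, block ρ x := by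
  ext i j
  rw [Matrix.sum_apply]
  rfl

lemma IsCQState.posSemidef_marginal {ρ : Matrix (Fin Q) (Fin Q) (N → ℂ)} (h : IsCQState ρ) :
    (marginal ρ).PosSemidef := by
  rw [marginal_eq_sum_block]
  exact Matrix.posSemidef_sum _ fun x _ => h.posSemidef_block x

lemma IsCQState.trace_marginal {ρ : Matrix (Fin Q) (Fin Q) (N → ℂ)} (h : IsCQState ρ) :
    (marginal ρ).trace = 1 := by
  rw [← h.2, ← Matrix.one_mul (blockEmbed ρ), trace_mul_blockEmbed, marginal_eq_sum_block,
    Matrix.trace_sum]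
  refine Finset.sum_congr rfl fun x _ => ?_
  have : diagBlock (1 : Matrix (Fin Q × N) (Fin Q × N) ℂ) x = 1 := by
    ext i j
    simp [diagBlock, Matrix.one_apply]
  rw [this, Matrix.one_mul]

/-- The nonnegative quadratic forms of the blocks sum to zero at v, so each one vanishes there. -/
lemma IsCQState.block_mulVec_eq_zero {ρ : Matrix (Fin Q) (Fin Q) (N → ℂ)} (h : IsCQState ρ)
    {v : Fin Q → ℂ} (hv : marginal ρ *ᵥ v = 0) (x : N) : block ρ x *ᵥ v = 0 := by
  have h0 : ∑ x, star v ⬝ᵥ (block ρ x *ᵥ v) = 0 := by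
    rw [← dotProduct_sum, ← Matrix.sum_mulVec, ← marginal_eq_sum_block, hv, dotProduct_zero]
  have hx := (Finset.sum_eq_zero_iff_of_nonneg fun x _ =>
    (h.posSemidef_block x).dotProduct_mulVec_nonneg v).mp h0 x (Finset.mem_univ x)
  exact ((h.posSemidef_block x).dotProduct_mulVec_zero_iff v).mp hx

/-- If `σ^(-1/2) ρ σ^(-1/2) ≤ r` then `ρ x ≤ r σ`, when the support of `σ` contains that of
`ρ_Q`. -/
lemma IsCQState.posSemidef_smul_sub_block {ρ : Matrix (Fin Q) (Fin Q) (N → ℂ)}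
    (h : IsCQState ρ) {σ : Matrix (Fin Q) (Fin Q) ℂ} (hσ : σ.PosSemidef)
    (hsupp : ∀ v, σ *ᵥ v = 0 → marginal ρ *ᵥ v = 0) {r : ℝ}
    (hr : opNorm ((invSqrt σ ⊗ₖ (1 : Matrix N N ℂ)) * blockEmbed ρ *
      (invSqrt σ ⊗ₖ (1 : Matrix N N ℂ))) ≤ r) (x : N) : (r • σ - block ρ x).PosSemidef := by
  have hsa : IsSelfAdjoint σ := hσ.1
  have hc : ∀ g : ℝ → ℝ, ContinuousOn g (spectrum ℝ σ) := fun g =>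
    (Matrix.finite_real_spectrum).continuousOn g
  have hpos := spectrum_nonneg hσ
  have hGH : (invSqrt σ)ᴴ = invSqrt σ := cfc_predicate (R := ℝ) _ σ
  set S := cfc Real.sqrt σ with hS
  have hSH : Sᴴ = S := (posSemidef_cfc_sqrt σ).1.eq
  have hSS : S * S = σ := cfc_sqrt_mul_self hσ
  set E := invSqrt σ * S with hE
  have hEc : E = cfc (fun t : ℝ => (Real.sqrt t)⁻¹ * Real.sqrt t) σ :=
    (cfc_mul _ _ σ (hc _) (hc _)).symm
  have hσE : σ * E = σ := by
    rw [hEc]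
    nth_rewrite 1 [← cfc_id' ℝ σ]
    rw [← cfc_mul _ _ σ (hc _) (hc _)]
    conv_rhs => rw [← cfc_id' ℝ σ]
    refine cfc_congr fun t ht => ?_
    rcases (hpos t ht).eq_or_lt with h0 | h0
    · simp [← h0]
    · have := Real.sqrt_pos.mpr h0
      simp [this.ne']
  -- E is the support projection of σ: the columns of 1 - E lie in the kernel of σ, hence in that of
  -- ρ_Q, hence in that of every block.
  have hρE : block ρ x * E = block ρ x := by
    refine Matrix.ext_of_mulVec_single fun i => ?_
    rw [← sub_eq_zero, ← Matrix.mulVec_mulVec, ← Matrix.mulVec_sub]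
    refine h.block_mulVec_eq_zero (hsupp _ ?_) x
    rw [Matrix.mulVec_sub, Matrix.mulVec_mulVec, hσE, sub_self]
  have hEρE : Eᴴ * block ρ x * E = block ρ x := by
    rw [Matrix.mul_assoc, hρE]
    have := congrArg Matrix.conjTranspose hρE
    rwa [Matrix.conjTranspose_mul, (h.posSemidef_block x).1.eq] at this
  have hbig := posSemidef_diagBlock (posSemidef_smul_one_sub (r := r) (A :=
    (invSqrt σ ⊗ₖ (1 : Matrix N N ℂ)) * blockEmbed ρ * (invSqrt σ ⊗ₖ (1 : Matrix N N ℂ))) (by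
      rw [Matrix.IsHermitian, Matrix.conjTranspose_mul, Matrix.conjTranspose_mul,
        Matrix.conjTranspose_kronecker, Matrix.conjTranspose_one, hGH, h.1.1.eq,
        Matrix.mul_assoc]) hr) x
  have e : diagBlock (r • (1 : Matrix (Fin Q × N) (Fin Q × N) ℂ) -
      (invSqrt σ ⊗ₖ (1 : Matrix N N ℂ)) * blockEmbed ρ * (invSqrt σ ⊗ₖ (1 : Matrix N N ℂ))) x =
      r • (1 : Matrix (Fin Q) (Fin Q) ℂ) - invSqrt σ * block ρ x * invSqrt σ := by
    rw [← diagBlock_blockEmbed, ← diagBlock_kronecker_mul]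
    ext i j
    simp [diagBlock, Matrix.one_apply]
  rw [e] at hbig
  -- Conjugation by σ^(1/2) undoes σ^(-1/2) up to E, which the block absorbs.
  have hconj := hbig.mul_mul_conjTranspose_same S
  have e2 : S * (r • (1 : Matrix (Fin Q) (Fin Q) ℂ) - invSqrt σ * block ρ x * invSqrt σ) * Sᴴ =
      r • σ - Eᴴ * block ρ x * E := by
    rw [hE, Matrix.conjTranspose_mul, hSH, hGH, Matrix.mul_sub, Matrix.sub_mul, Matrix.mul_smul,
      Matrix.smul_mul, Matrix.mul_one, hSS]
    simp only [Matrix.mul_assoc]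
  rwa [e2, hEρE] at hconj

lemma IsCQState.exists_opNorm_lt {ρ : Matrix (Fin Q) (Fin Q) (N → ℂ)} (h : IsCQState ρ) {k r : ℝ}
    (hk : k ≤ condMinEntropy ρ) (hr : (2 : ℝ) ^ (-k) < r) :
    ∃ σ : Matrix (Fin Q) (Fin Q) ℂ, σ.PosSemidef ∧ σ.trace = 1 ∧
      (∀ v, σ *ᵥ v = 0 → marginal ρ *ᵥ v = 0) ∧
      opNorm ((invSqrt σ ⊗ₖ (1 : Matrix N N ℂ)) * blockEmbed ρ *
        (invSqrt σ ⊗ₖ (1 : Matrix N N ℂ))) < r := by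
  rw [condMinEntropy] at hk
  set T : Set ℝ := {r : ℝ | ∃ σ : Matrix (Fin Q) (Fin Q) ℂ, σ.PosSemidef ∧ σ.trace = 1 ∧
    (∀ v, σ *ᵥ v = 0 → marginal ρ *ᵥ v = 0) ∧
    r = opNorm ((invSqrt σ ⊗ₖ (1 : Matrix N N ℂ)) * blockEmbed ρ *
      (invSqrt σ ⊗ₖ (1 : Matrix N N ℂ)))} with hT
  have hne : T.Nonempty :=
    ⟨_, marginal ρ, h.posSemidef_marginal, h.trace_marginal, fun _ hv => hv, rfl⟩
  have h0 : 0 ≤ sInf T := Real.sInf_nonneg (by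
    rintro _ ⟨σ, -, -, -, rfl⟩
    exact opNorm_nonneg _)
  have hlt : sInf T < r := by
    -- If the infimum is 0, the entropy takes the default value of `Real.logb` at 0 and `hk` says
    -- nothing; the claim then holds because r > 0.
    rcases h0.eq_or_lt with h0 | h0
    · rw [← h0]
      exact (by positivity : (0 : ℝ) < (2 : ℝ) ^ (-k)).trans hr
    · refine lt_of_le_of_lt ?_ hr
      rwa [← Real.logb_le_iff_le_rpow one_lt_two h0, le_neg]
  obtain ⟨_, ⟨σ, h1, h2, h3, rfl⟩, h4⟩ := exists_lt_of_csInf_lt hne hlt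
  exact ⟨σ, h1, h2, h3, h4⟩

/-- A faithful state `R²` dominating both a given state and the marginal of `ρ`, up to a
factor `3`. -/
lemma IsCQState.exists_faithful {ρ : Matrix (Fin Q) (Fin Q) (N → ℂ)} (h : IsCQState ρ)
    {σ : Matrix (Fin Q) (Fin Q) ℂ} (hσ : σ.PosSemidef) (hσ1 : σ.trace = 1) :
    ∃ R : Matrix (Fin Q) (Fin Q) ℂ, R.PosSemidef ∧ IsUnit R ∧ (R * R).trace = 1 ∧
      ((3 : ℝ) • (R * R) - σ).PosSemidef ∧ ((3 : ℝ) • (R * R) - marginal ρ).PosSemidef := by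
  have hρ := h.posSemidef_marginal
  have hQ : (0 : ℝ) < Q := by
    rcases Nat.eq_zero_or_pos Q with rfl | hQ
    · simp [Matrix.trace] at hσ1
    · exact_mod_cast hQ
  have hQ' : (Q : ℂ) ≠ 0 := by exact_mod_cast hQ.ne'
  have hone : ((Q : ℝ)⁻¹ • (1 : Matrix (Fin Q) (Fin Q) ℂ)).PosDef :=
    Matrix.PosDef.one.smul (by positivity)
  -- The average of σ, ρ_Q and the maximally mixed state; the last term makes it invertible.
  set τ := (3 : ℝ)⁻¹ • (σ + marginal ρ + (Q : ℝ)⁻¹ • (1 : Matrix (Fin Q) (Fin Q) ℂ)) with hτ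
  have hτd : τ.PosDef := (Matrix.PosDef.posSemidef_add (hσ.add hρ) hone).smul (by norm_num)
  have hRR : cfc Real.sqrt τ * cfc Real.sqrt τ = τ := cfc_sqrt_mul_self hτd.posSemidef
  have h3 : (3 : ℝ) • τ = σ + marginal ρ + (Q : ℝ)⁻¹ • (1 : Matrix (Fin Q) (Fin Q) ℂ) := by
    rw [hτ, smul_smul]
    norm_num
  refine ⟨cfc Real.sqrt τ, posSemidef_cfc_sqrt τ, ?_, ?_, ?_, ?_⟩
  · refine isUnit_of_mul_isUnit_left (y := cfc Real.sqrt τ) ?_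
    rw [hRR]
    exact hτd.isUnit
  · rw [hRR, hτ, Matrix.trace_smul, Matrix.trace_add, Matrix.trace_add, Matrix.trace_smul,
      hσ1, h.trace_marginal, Matrix.trace_one, Fintype.card_fin]
    simp only [Complex.real_smul]
    push_cast
    field_simp
    norm_num
  · rw [hRR, h3]
    convert hρ.add hone.posSemidef using 1
    abel
  · rw [hRR, h3]
    convert hσ.add hone.posSemidef using 1
    abel

variable {D M : Type*} [Fintype D] [Fintype M] [DecidableEq M]

lemma IsStrongExtractor.isQuantumProof [Nonempty D] [Nonempty M] {f : D → N → M} {k ε : ℝ}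
    (hε : 0 < ε) (hf : IsStrongExtractor f k ε) :
    IsQuantumProofStrongExtractor f (k + Real.logb 2 (2 / ε))
      (Real.sqrt (Fintype.card M * (6 * ε))) := by
  intro Q ρ hρ hk
  have hD : (Fintype.card D : ℝ) ≠ 0 := by simp
  have h2k : (0 : ℝ) < (2 : ℝ) ^ (-k) := by positivity
  -- The 2 in log(2/ε) makes this strict, so a σ within the bound exists even without attainment of
  -- the minimum.
  have hlt : (2 : ℝ) ^ (-(k + Real.logb 2 (2 / ε))) < ε * (2 : ℝ) ^ (-k) := by
    rw [neg_add, Real.rpow_add two_pos, Real.rpow_neg two_pos.le (Real.logb 2 (2 / ε)),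
      Real.rpow_logb two_pos (by norm_num) (by positivity), inv_div]
    nlinarith
  obtain ⟨σ, hσ, hσ1, hsupp, hσr⟩ := hρ.exists_opNorm_lt hk hlt
  obtain ⟨R, hR, hRu, hR1, hRσ, hRρ⟩ := hρ.exists_faithful hσ hσ1
  set c := ε * (2 : ℝ) ^ (-k) with hc
  have hc0 : 0 < c := by positivity
  have hdom : ∀ x, ((3 * c) • (R * R) - block ρ x).PosSemidef := fun x => by
    have h1 := hρ.posSemidef_smul_sub_block hσ hsupp hσr.le x
    have h2 := (hRσ.smul hc0.le).add h1
    convert h2 using 1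
    rw [smul_sub, smul_smul, mul_comm c, sub_add_sub_cancel]
  have hdet : IsUnit R.det := (Matrix.isUnit_iff_isUnit_det R).mp hRu
  have hinvH : R⁻¹ᴴ = R⁻¹ := by rw [Matrix.conjTranspose_nonsing_inv, hR.1.eq]
  set z : N → Matrix (Fin Q) (Fin Q) ℂ := fun x => R⁻¹ * block ρ x * R⁻¹ with hz
  have hzpos : ∀ x, (z x).PosSemidef := fun x => by
    have := (hρ.posSemidef_block x).mul_mul_conjTranspose_same R⁻¹
    rwa [hinvH] at this
  have hRzR : ∀ x, R * z x * R = block ρ x := fun x => by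
    simp only [hz]
    rw [Matrix.mul_assoc, Matrix.mul_assoc, Matrix.nonsing_inv_mul R hdet, Matrix.mul_one,
      ← Matrix.mul_assoc, Matrix.mul_nonsing_inv R hdet, Matrix.one_mul]
  have hRRz : ∀ x, (R * R * z x).trace = (block ρ x).trace := fun x => by
    rw [← hRzR x, Matrix.mul_assoc, Matrix.trace_mul_comm]
  set w : N → ℝ := fun x => (block ρ x).trace.re with hw
  have hw0 : ∀ x, 0 ≤ w x := fun x =>
    (Complex.le_def.mp (hρ.posSemidef_block x).trace_nonneg).1
  have hw1 : ∑ x, w x ≤ 1 := by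
    simp only [hw]
    rw [← Complex.re_sum, ← Matrix.trace_sum, ← marginal_eq_sum_block, hρ.trace_marginal]
    simp
  have htr : ∀ (t : ℝ) (x : N), (t • (R * R) * z x).trace.re = t * w x := fun t x => by
    rw [Matrix.smul_mul, Matrix.trace_smul, hRRz, Complex.real_smul, Complex.re_ofReal_mul]
  -- Since R z_x R = ρ_x, the vector is Tr(ρ_x z_{x'}). Its sup bound comes from ρ_x ≤ 3cR², its
  -- mass bound from ρ_Q ≤ 3R², and Tr(R² z_{x'}) = Tr ρ_{x'} is the weight.
  have hbound : ∀ x', ∑ p, |∑ x, deltaCoef f p x * (R * z x * R * (z x')ᴴ).trace.re| ≤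
      6 * ε * w x' := fun x' => by
    simp only [hRzR, (hzpos x').1.eq]
    refine hf.sum_abs_deltaCoef_le hε _
      (fun x => trace_mul_re_nonneg (hρ.posSemidef_block x) (hzpos x')) (hw0 x') (fun x => ?_) ?_
    · rw [← hc, ← htr]
      exact trace_mul_re_mono (hdom x) (hzpos x')
    · rw [← htr, ← Complex.re_sum, ← Matrix.trace_sum, ← Finset.sum_mul,
        ← marginal_eq_sum_block]
      exact trace_mul_re_mono hRρ (hzpos x')
  choose U hU hUt using fun s : D => exists_traceNorm_eq
    (blockEmbed (ρ.map (push ℂ (f s)) - tensorUniform M (marginal ρ)))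
  have hsum : (Fintype.card D : ℝ)⁻¹ *
      ∑ s, traceNorm (blockEmbed (ρ.map (push ℂ (f s)) - tensorUniform M (marginal ρ))) =
      ∑ p : M × D, (diagBlock (U p.2) p.1 * R * (∑ x, deltaCoef f p x • z x) * R).trace.re := by
    rw [Fintype.sum_prod_type_right, Finset.mul_sum]
    refine Finset.sum_congr rfl fun s _ => ?_
    rw [hUt, trace_mul_blockEmbed, Complex.re_sum, Finset.mul_sum]
    refine Finset.sum_congr rfl fun y _ => ?_
    rw [block_map_push_sub, Matrix.mul_smul, Matrix.trace_smul, Complex.real_smul,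
      Complex.re_ofReal_mul, inv_mul_cancel_left₀ hD]
    simp only [← hRzR]
    simp only [Matrix.mul_assoc, Matrix.mul_sum, Matrix.sum_mul, Matrix.mul_smul,
      Matrix.smul_mul]
  rw [hsum]
  refine (sum_trace_deltaCoef_le f z hR hR (by rw [hR1]; simp) (by rw [hR1]; simp)
    (fun p => diagBlock (U p.2) p.1) (fun p => (opNorm_diagBlock_le _ _).trans (hU _)) w
    (by positivity) hw1 hbound).trans_eq ?_
  rw [mul_one]

end States

end QExt

theorem theorem3 {𝕜 : Type*} [RCLike 𝕜] {n d m' : ℕ}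
    (f : (Fin d → Bool) → (Fin n → Bool) → (Fin m' → Bool)) (k ε : ℝ) (hε : 0 < ε) :
    (QExt.boundedNorm
          (fun P => ENNReal.ofReal (QExt.capNorm ((2 : ℝ) ^ k) P))
          (fun R => ENNReal.ofReal (QExt.l1Norm R))
          (QExt.deltaS 𝕜 f) ≤ ENNReal.ofReal ε →
      QExt.cbNorm
          (QExt.capcapNorm ((2 : ℝ) ^ (k + Real.logb 2 (1 / ε))))
          QExt.l1OpNorm
          (QExt.deltaS ℂ f)
        ≤ ENNReal.ofReal (4 * Real.sqrt ((2 : ℝ) ^ m') * Real.sqrt (2 * ε))) ∧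
    (QExt.IsStrongExtractor f k ε →
      QExt.IsQuantumProofStrongExtractor f (k + Real.logb 2 (2 / ε))
        (12 * Real.sqrt ((2 : ℝ) ^ m') * Real.sqrt (2 * ε))) := by
  have hcard : (Fintype.card (Fin m' → Bool) : ℝ) = (2 : ℝ) ^ m' := by simp
  have hsqrt : Real.sqrt ((2 : ℝ) ^ m' * (2 * ε)) =
      Real.sqrt ((2 : ℝ) ^ m') * Real.sqrt (2 * ε) := Real.sqrt_mul (by positivity) _
  refine ⟨fun h => ?_, fun h Q ρ hρ hk => ?_⟩
  · have hK : (2 : ℝ) ^ (k + Real.logb 2 (1 / ε)) = (2 : ℝ) ^ k / ε := by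
      rw [Real.rpow_add two_pos, Real.rpow_logb two_pos (by norm_num) (by positivity),
        mul_one_div]
    rw [hK]
    refine (QExt.cbNorm_deltaS_le f hε
      (QExt.sum_abs_deltaCoef_le_of_boundedNorm f hε h (by positivity))).trans
      (ENNReal.ofReal_le_ofReal ?_)
    rw [hcard, hsqrt, mul_assoc]
    gcongr
    norm_num
  · refine (h.isQuantumProof hε Q ρ hρ hk).trans ?_
    rw [hcard, mul_assoc, ← hsqrt]
    -- After squaring, the claim is 6 ≤ 144 · 2.
    refine Real.sqrt_le_iff.mpr ⟨by positivity, ?_⟩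
    rw [mul_pow, Real.sq_sqrt (by positivity)]
    have : 0 < (2 : ℝ) ^ m' * ε := by positivity
    nlinarith
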